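/- Let $d\ge 3$, let $\mathbb R^k$ carry the maximum norm, let $\tau>0$, and let $f,g:\mathbb R^d\to\mathbb R^d$ be Lipschitz and bounded, $\|f\|\le M_f$, $\|g\|\le M_g$ with $M_f,M_g>0$. Let $\Phi$ be the flow of $u'=f(u)$, and for $\varepsilon\in\mathbb R$ let $\varphi_\varepsilon$ be the semiflow of $$u'(t)=f(u(t))+\varepsilon\, g(u(t-\tau)),\qquad \varphi_\varepsilon(t,u_0)=u_t,\quad u_t(s)=u(t+s),$$ on $\mathcal C=C([-\tau,0],\mathbb R^d)$ with the supremum norm. *Section and Poincaré map.* Let $S\subset\mathbb R^d$ be a section: a smooth $(d-1)$-dimensional submanifold for which there are $\delta>0$, $a>0$ and a function $\alpha$ such that $\Phi$ restricted to $(-\delta,\delta)\times S$ is a homeomorphism onto its image $U$ (an open set), $\alpha:U\to\mathbb R$ is $C^1$, $S=\{u\in U:\alpha(u)=0\}$, $\nabla\alpha\cdot f\ge a$ on $U$, and $\alpha(\Phi(t,u))<0$ for $t\in(-\delta,0)$, $\alpha(\Phi(t,u))>0$ for $t\in(0,\delta)$, $u\in S$. Let $\Sigma\subset S$ be relatively open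 and such that each point of $\Sigma$ returns to $S$, and let $t_P(u)=\inf\{t>0:\Phi(t,u)\in S\}$ and $P(u)=\Phi(t_P(u),u)$ for $u\in\Sigma$. Fix coordinates on $S$, that is a homeomorphism $\kappa$ from a relatively open subset $S_0$ of $S$ (for example $S_0=S$) onto an open subset of $\mathbb R^{d-1}$. They identify points of $S_0$ with points of $\mathbb R^{d-1}$ and functions $\phi\in\mathcal C$ with $\phi(0)\in S_0$ with pairs $(\kappa(\phi(0)),\phi-\phi(0))\in\mathbb R^{d-1}\times\mathcal X_2$, where $\mathcal X_2=\{\eta\in\mathcal C:\eta(0)=0\}$. *Coverings.* Let $B$ be the closed unit ball of $\mathbb R^{d-2}$. A (horizontal) h-set $N$ in $\mathbb R^{d-1}=\mathbb R\times\mathbb R^{d-2}$ is a compact set $|N|$ with a homeomorphism $c_N$ of $\mathbb R^{d-1}$ such that $c_N(|N|)=[-1,1]\times B$; put $N^-=c_N^{-1}(\{-1,1\}\times B)$ and $N^+=c_N^{-1}([-1,1]\times\partial B)$. For a continuous $F:|N|\to\mathbb R^{d-1}$ we say that $N$ $F$-covers $M$ if there are a continuous homotopy $H:[0,1]\times|N|\to\mathbb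 R^{d-1}$ and $b\in\mathbb R\setminus[-1,1]$ with $H(0,\cdot)=F$, $H([0,1]\times N^-)\cap|M|=\emptyset$, $H([0,1]\times|N|)\cap M^+=\emptyset$ and $c_M(H(1,c_N^{-1}(p,q)))=(bp,0)$ for all $(p,q)\in[-1,1]\times B$. An h-set with tail is a pair $N=(N_1,N_2)$ of an h-set $N_1$ and a closed, convex, bounded set $N_2\subset\mathcal X_2$, with $|N|=|N_1|\times N_2$. For a continuous compact map $F:|N|\to\mathbb R^{d-1}\times\mathcal X_2$ (it sends bounded sets to relatively compact ones) we say that $N$ $F$-covers $M$ if there are a continuous compact homotopy $H:[0,1]\times|N|\to\mathbb R^{d-1}\times M_2$, $b\in\mathbb R\setminus[-1,1]$ and $\bar r\in M_2$ with $H(0,\cdot)=F$, $H([0,1]\times N_1^-\times N_2)\cap|M|=\emptyset$, $H([0,1]\times|N|)\cap(M_1^+\times M_2)=\emptyset$ and $H(1,(x,r))=(y,\bar r)$ with $c_{M_1}(y)=(bp,0)$ whenever $c_{N_1}(x)=(p,q)\in[-1,1]\times B$ and $r\in N_2$. *Theorem.* Let $(N_i)_{i\in I}$ be a finite family of h-sets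 in $\mathbb R^{d-1}$ whose supports lie in $\kappa(S_0\cap\Sigma)$, and let $C\subset I\times I$ be such that for each $(i,j)\in C$ one has $P(\kappa^{-1}(|N_i|))\subset S_0$ and $N_i$ $P$-covers $N_j$ ($P$ being read in the coordinates $\kappa$). Let $0<\eta<\delta$. For $L\ge 0$ let $\Omega_L\subset\mathcal X_2$ be the set of functions with Lipschitz constant $L$ that vanish at $0$. Then there is $\varepsilon_C>0$ such that for every $\varepsilon$ with $|\varepsilon|\le\varepsilon_C$: 1. for all $(i,j)\in C$ and all $\phi\in\mathcal C$ with $\phi(0)\in\kappa^{-1}(|N_i|)$ there is exactly one time $t_{\bar P}(\phi)\in[t_P(\phi(0))-\eta,\,t_P(\phi(0))+\eta]$ with $\varphi_\varepsilon(t_{\bar P}(\phi),\phi)(0)\in S$, and the map $\bar P(\phi)=\varphi_\varepsilon(t_{\bar P}(\phi),\phi)$ satisfies $\bar P(\phi)(0)\in S_0$; 2. for all $(i,j)\in C$ the h-set with tail $(N_i,\Omega_{M_f+|\varepsilon|M_g})$ $\bar P$-covers $(N_j,\Omega_{M_f+|\varepsilon|M_g})$, where $\bar P$ is read in the coordinates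 $\phi\mapsto(\kappa(\phi(0)),\phi-\phi(0))$ of the section $\bar S=\{\phi\in\mathcal C:\phi(0)\in S\}$; 3. if $P$ is continuous on $\Sigma$, then $\bar P$ is the first return map to $\bar S$: for $\phi$ as in 1, $t_{\bar P}(\phi)$ is the least $t>0$ with $\varphi_\varepsilon(t,\phi)(0)\in S$. -/

import Mathlib

open Set Topology
open scoped NNReal ContDiff

noncomputable section

namespace DelayPerturb

/-! ### Horizontal h-sets and covering relations in finite dimension

`ℝ^(m+1)` is written as `ℝ × (Fin m → ℝ)`, with the maximum norm. -/

/-- A horizontal h-set in `ℝ^(m+1) = ℝ × ℝ^m` (one exit direction): a compact support with a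
homeomorphism of the whole space that carries it onto `[-1,1] × B̄`. -/
structure HSet (m : ℕ) where
  support : Set (ℝ × (Fin m → ℝ))
  isCompact_support : IsCompact support
  c : (ℝ × (Fin m → ℝ)) ≃ₜ (ℝ × (Fin m → ℝ))
  image_support : c '' support = Icc (-1 : ℝ) 1 ×ˢ Metric.closedBall (0 : Fin m → ℝ) 1

/-- The exit set `N⁻`. -/
def HSet.exit {m : ℕ} (N : HSet m) : Set (ℝ × (Fin m → ℝ)) :=
  N.c ⁻¹' (({-1, 1} : Set ℝ) ×ˢ Metric.closedBall (0 : Fin m → ℝ) 1)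

/-- The entry set `N⁺`. -/
def HSet.entry {m : ℕ} (N : HSet m) : Set (ℝ × (Fin m → ℝ)) :=
  N.c ⁻¹' (Icc (-1 : ℝ) 1 ×ˢ frontier (Metric.closedBall (0 : Fin m → ℝ) 1))

/-- `N` covers `M` horizontally through `F : |N| → ℝ^(m+1)`. -/
def HSet.Covers {m : ℕ} (F : ℝ × (Fin m → ℝ) → ℝ × (Fin m → ℝ)) (N M : HSet m) : Prop :=
  ContinuousOn F N.support ∧
  ∃ H : ℝ × (ℝ × (Fin m → ℝ)) → ℝ × (Fin m → ℝ),
    ContinuousOn H (Icc (0 : ℝ) 1 ×ˢ N.support) ∧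
    (∀ x ∈ N.support, H (0, x) = F x) ∧
    (∀ t ∈ Icc (0 : ℝ) 1, ∀ x ∈ N.exit, H (t, x) ∉ M.support) ∧
    (∀ t ∈ Icc (0 : ℝ) 1, ∀ x ∈ N.support, H (t, x) ∉ M.entry) ∧
    ∃ a : ℝ, a ∉ Icc (-1 : ℝ) 1 ∧
      ∀ p ∈ Icc (-1 : ℝ) 1, ∀ q ∈ Metric.closedBall (0 : Fin m → ℝ) 1,
        M.c (H (1, N.c.symm (p, q))) = (a * p, 0)

/-- `C` is a collection of covering relations on the family `N` for the map `F`. -/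
def IsCoveringCollection {m : ℕ} {ι : Type*} (N : ι → HSet m) (C : Set (ι × ι))
    (F : ℝ × (Fin m → ℝ) → ℝ × (Fin m → ℝ)) : Prop :=
  ∀ p ∈ C, (N p.1).Covers F (N p.2)

/-! ### h-sets with tails and their covering relations -/

/-- A continuous map on `D` that sends bounded subsets of `D` to relatively compact sets. -/
def IsCompactMapOn {X Y : Type*} [PseudoMetricSpace X] [TopologicalSpace Y]
    (F : X → Y) (D : Set X) : Prop :=
  ContinuousOn F D ∧ ∀ A ⊆ D, Bornology.IsBounded A → IsCompact (closure (F '' A))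

/-- A horizontal h-set with tail in the Banach space `ℝ^(m+1) × X₂`. -/
structure HSetTail (m : ℕ) (X₂ : Type*) [NormedAddCommGroup X₂] [NormedSpace ℝ X₂]
    [CompleteSpace X₂] where
  head : HSet m
  tail : Set X₂
  isClosed_tail : IsClosed tail
  convex_tail : Convex ℝ tail
  isBounded_tail : Bornology.IsBounded tail

/-- `|N| = |N₁| × |N₂|`. -/
def HSetTail.support {m : ℕ} {X₂ : Type*} [NormedAddCommGroup X₂] [NormedSpace ℝ X₂]
    [CompleteSpace X₂] (N : HSetTail m X₂) : Set ((ℝ × (Fin m → ℝ)) × X₂) :=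
  N.head.support ×ˢ N.tail

/-- `N` covers `M` through `F : |N| → ℝ^(m+1) × X₂`, for h-sets with tails. -/
def HSetTail.Covers {m : ℕ} {X₂ : Type*} [NormedAddCommGroup X₂] [NormedSpace ℝ X₂]
    [CompleteSpace X₂] (F : (ℝ × (Fin m → ℝ)) × X₂ → (ℝ × (Fin m → ℝ)) × X₂)
    (N M : HSetTail m X₂) : Prop :=
  IsCompactMapOn F N.support ∧
  ∃ H : ℝ × ((ℝ × (Fin m → ℝ)) × X₂) → (ℝ × (Fin m → ℝ)) × X₂,
    IsCompactMapOn H (Icc (0 : ℝ) 1 ×ˢ N.support) ∧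
    (∀ t ∈ Icc (0 : ℝ) 1, ∀ x ∈ N.support, (H (t, x)).2 ∈ M.tail) ∧
    (∀ x ∈ N.support, H (0, x) = F x) ∧
    (∀ t ∈ Icc (0 : ℝ) 1, ∀ x ∈ N.head.exit ×ˢ N.tail, H (t, x) ∉ M.support) ∧
    (∀ t ∈ Icc (0 : ℝ) 1, ∀ x ∈ N.support, H (t, x) ∉ M.head.entry ×ˢ M.tail) ∧
    ∃ a : ℝ, a ∉ Icc (-1 : ℝ) 1 ∧ ∃ r₀ ∈ M.tail,
      ∀ p ∈ Icc (-1 : ℝ) 1, ∀ q ∈ Metric.closedBall (0 : Fin m → ℝ) 1, ∀ r ∈ N.tail,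
        M.head.c (H (1, (N.head.c.symm (p, q), r))).1 = (a * p, 0) ∧
        (H (1, (N.head.c.symm (p, q), r))).2 = r₀

/-- `C` is a collection of covering relations on the family `N` of h-sets with tails for `F`. -/
def IsTailCoveringCollection {m : ℕ} {X₂ : Type*} [NormedAddCommGroup X₂] [NormedSpace ℝ X₂]
    [CompleteSpace X₂] {ι : Type*} (N : ι → HSetTail m X₂) (C : Set (ι × ι))
    (F : (ℝ × (Fin m → ℝ)) × X₂ → (ℝ × (Fin m → ℝ)) × X₂) : Prop :=
  ∀ p ∈ C, (N p.1).Covers F (N p.2)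

/-! ### The ODE `u' = f(u)`, sections and Poincaré maps -/

/-- `f` is bounded by `M > 0` and Lipschitz with constant `L > 0`, in the maximum norm. -/
structure BoundedLipschitz {d : ℕ} (f : (Fin d → ℝ) → (Fin d → ℝ)) (M : ℝ) (L : ℝ≥0) :
    Prop where
  bound_pos : 0 < M
  lip_pos : 0 < L
  bound : ∀ u, ‖f u‖ ≤ M
  lip : LipschitzWith L f

open Classical in
/-- The flow `Φ(t, x)` of `u' = f(u)`: the value at time `t` of the solution with `u(0) = x`
(unique and global for bounded Lipschitz `f`). -/
def odeFlow {d : ℕ} (f : (Fin d → ℝ) → (Fin d → ℝ)) (t : ℝ) (x : Fin d → ℝ) : Fin d → ℝ :=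
  if h : ∃ u : ℝ → (Fin d → ℝ), u 0 = x ∧ ∀ s, HasDerivAt u (f (u s)) s then h.choose t else x

/-- Smooth embedded submanifold of codimension one: locally the zero set of a smooth function
with nonvanishing differential. -/
def IsSmoothHypersurface {d : ℕ} (S : Set (Fin d → ℝ)) : Prop :=
  ∀ x ∈ S, ∃ W : Set (Fin d → ℝ), IsOpen W ∧ x ∈ W ∧ ∃ h : (Fin d → ℝ) → ℝ,
    ContDiffOn ℝ ∞ h W ∧ (∀ y ∈ W, fderiv ℝ h y ≠ 0) ∧ S ∩ W = {y ∈ W | h y = 0}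

/-- `U = Φ((-δ, δ) × S)`. -/
def flowBox {d : ℕ} (f : (Fin d → ℝ) → (Fin d → ℝ)) (S : Set (Fin d → ℝ)) (δ : ℝ) :
    Set (Fin d → ℝ) :=
  (fun p : ℝ × (Fin d → ℝ) => odeFlow f p.1 p.2) '' (Ioo (-δ) δ ×ˢ S)

/-- `S` is a section for the flow of `u' = f(u)`, with box half-width `δ`, defining function `α`
and transversality constant `a`. Openness of the box is automatic (invariance of domain); it is
recorded so that `α` can be differentiated there. -/
structure IsSection {d : ℕ} (f : (Fin d → ℝ) → (Fin d → ℝ)) (S : Set (Fin d → ℝ))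
    (δ : ℝ) (α : (Fin d → ℝ) → ℝ) (a : ℝ) : Prop where
  smooth : IsSmoothHypersurface S
  delta_pos : 0 < δ
  homeo : IsEmbedding ((Ioo (-δ) δ ×ˢ S).domRestrict fun p => odeFlow f p.1 p.2)
  isOpen_box : IsOpen (flowBox f S δ)
  contDiff : ContDiffOn ℝ 1 α (flowBox f S δ)
  zero_set : S = {u ∈ flowBox f S δ | α u = 0}
  a_pos : 0 < a
  transversal : ∀ u ∈ flowBox f S δ, a ≤ fderiv ℝ α u (f u)
  neg_before : ∀ t ∈ Ioo (-δ) 0, ∀ u ∈ S, α (odeFlow f t u) < 0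
  pos_after : ∀ t ∈ Ioo 0 δ, ∀ u ∈ S, 0 < α (odeFlow f t u)

/-- `t_P(u) = inf {t > 0 : Φ(t, u) ∈ S}`. -/
def odeReturnTime {d : ℕ} (f : (Fin d → ℝ) → (Fin d → ℝ)) (S : Set (Fin d → ℝ))
    (u : Fin d → ℝ) : ℝ :=
  sInf {t | 0 < t ∧ odeFlow f t u ∈ S}

/-- The Poincaré map `P(u) = Φ(t_P(u), u)`. -/
def odePoincare {d : ℕ} (f : (Fin d → ℝ) → (Fin d → ℝ)) (S : Set (Fin d → ℝ))
    (u : Fin d → ℝ) : Fin d → ℝ :=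
  odeFlow f (odeReturnTime f S u) u

/-- `D` is an admissible domain of the Poincaré map: relatively open in `S`, and each of its
points returns to `S`. -/
structure IsReturnDomain {d : ℕ} (f : (Fin d → ℝ) → (Fin d → ℝ)) (S D : Set (Fin d → ℝ)) :
    Prop where
  relOpen : ∃ O : Set (Fin d → ℝ), IsOpen O ∧ D = S ∩ O
  returns : ∀ u ∈ D, ∃ t, 0 < t ∧ odeFlow f t u ∈ S

/-- Coordinates on the section: a homeomorphism from a relatively open subset of `S` (for
instance all of `S`) onto an open subset of `ℝ^(m+1)`. -/
structure SectionChart {d : ℕ} (S : Set (Fin d → ℝ)) (m : ℕ) extends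
    PartialHomeomorph (Fin d → ℝ) (ℝ × (Fin m → ℝ)) where
  relOpen_source : ∃ O : Set (Fin d → ℝ), IsOpen O ∧ source = S ∩ O
  isOpen_target : IsOpen target

/-- The Poincaré map in the coordinates of the section. -/
def odePoincareCoord {d m : ℕ} (f : (Fin d → ℝ) → (Fin d → ℝ)) {S : Set (Fin d → ℝ)}
    (κ : SectionChart S m) (x : ℝ × (Fin m → ℝ)) : ℝ × (Fin m → ℝ) :=
  κ.toFun (odePoincare f S (κ.invFun x))

/-! ### The phase space `C([-τ, 0], ℝ^d)` and its splitting `φ ↦ (φ(0), φ - φ(0))` -/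

/-- `C([-τ, 0], ℝ^d)` with the supremum norm. -/
abbrev Phase (τ : ℝ≥0) (d : ℕ) : Type := C(Icc (-(τ : ℝ)) 0, Fin d → ℝ)

/-- The point `0` of `[-τ, 0]`. -/
def zeroPt (τ : ℝ≥0) : Icc (-(τ : ℝ)) 0 := ⟨0, by simp⟩

/-- The closed subspace `{η : η(0) = 0}`. -/
def TailSpace (τ : ℝ≥0) (d : ℕ) : Submodule ℝ (Phase τ d) where
  carrier := {η | η (zeroPt τ) = 0}
  zero_mem' := by simp
  add_mem' := by
    intro x y hx hy
    simp only [mem_ofPred_eq] at hx hy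
    simp [hx, hy]
  smul_mem' := by
    intro c x hx
    simp only [mem_ofPred_eq] at hx
    simp [hx]

instance instCompleteTailSpace (τ : ℝ≥0) (d : ℕ) : CompleteSpace (TailSpace τ d) := by
  have h : IsClosed (TailSpace τ d : Set (Phase τ d)) := by
    change IsClosed {η : Phase τ d | η (zeroPt τ) = 0}
    exact isClosed_eq (continuous_eval_const _) continuous_const
  exact h.completeSpace_coe

/-- The tail `η = φ - φ(0)`. -/
def tailOf {τ : ℝ≥0} {d : ℕ} (φ : Phase τ d) : TailSpace τ d :=
  ⟨φ - ContinuousMap.const _ (φ (zeroPt τ)), by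
    change φ (zeroPt τ) - φ (zeroPt τ) = 0
    simp⟩

/-- The function with value `x` at `0` and tail `η`. -/
def glue {τ : ℝ≥0} {d : ℕ} (x : Fin d → ℝ) (η : TailSpace τ d) : Phase τ d :=
  ContinuousMap.const _ x + (η : Phase τ d)

/-- The functions vanishing at `0` that are Lipschitz with constant `L`. -/
def lipTail (τ : ℝ≥0) (d : ℕ) (L : ℝ) : Set (TailSpace τ d) :=
  {η | ∀ s t : Icc (-(τ : ℝ)) 0,
    ‖(η : Phase τ d) t - (η : Phase τ d) s‖ ≤ L * |(t : ℝ) - (s : ℝ)|}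

theorem isClosed_lipTail (τ : ℝ≥0) (d : ℕ) (L : ℝ) : IsClosed (lipTail τ d L) := by
  simp only [lipTail, ofPred_forall]
  refine isClosed_iInter fun s => isClosed_iInter fun t => isClosed_le ?_ continuous_const
  exact (((continuous_eval_const t).comp continuous_subtype_val).sub
    ((continuous_eval_const s).comp continuous_subtype_val)).norm

theorem convex_lipTail (τ : ℝ≥0) (d : ℕ) (L : ℝ) : Convex ℝ (lipTail τ d L) := by
  intro x hx y hy a b ha hb hab s t
  have h1 := hx s t
  have h2 := hy s t
  have e : ((a • x + b • y : TailSpace τ d) : Phase τ d) t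
      - ((a • x + b • y : TailSpace τ d) : Phase τ d) s
      = a • ((x : Phase τ d) t - (x : Phase τ d) s)
        + b • ((y : Phase τ d) t - (y : Phase τ d) s) := by
    simp only [Submodule.coe_add, Submodule.coe_smul, ContinuousMap.add_apply,
      ContinuousMap.smul_apply, smul_sub]
    abel
  rw [e]
  calc _ ≤ ‖a • ((x : Phase τ d) t - (x : Phase τ d) s)‖
        + ‖b • ((y : Phase τ d) t - (y : Phase τ d) s)‖ := norm_add_le _ _
    _ = a * ‖(x : Phase τ d) t - (x : Phase τ d) s‖
        + b * ‖(y : Phase τ d) t - (y : Phase τ d) s‖ := by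
      rw [norm_smul, norm_smul, Real.norm_of_nonneg ha, Real.norm_of_nonneg hb]
    _ ≤ a * (L * |(t : ℝ) - s|) + b * (L * |(t : ℝ) - s|) := by gcongr
    _ = L * |(t : ℝ) - s| := by rw [← add_mul, hab, one_mul]

theorem isBounded_lipTail (τ : ℝ≥0) (d : ℕ) (L : ℝ) :
    Bornology.IsBounded (lipTail τ d L) := by
  refine isBounded_iff_forall_norm_le.2 ⟨|L| * τ, fun η hη => ?_⟩
  change ‖(η : Phase τ d)‖ ≤ _
  rw [ContinuousMap.norm_le _ (by positivity)]
  intro t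
  have h0 : (η : Phase τ d) (zeroPt τ) = 0 := η.2
  have h := hη (zeroPt τ) t
  rw [h0, sub_zero] at h
  refine h.trans ?_
  have ht : |(t : ℝ) - (zeroPt τ : ℝ)| ≤ τ := by
    have h1 := t.2.1
    have h2 := t.2.2
    simp only [zeroPt, sub_zero]
    rw [abs_of_nonpos h2]
    linarith
  calc L * |(t : ℝ) - (zeroPt τ : ℝ)| ≤ |L| * |(t : ℝ) - (zeroPt τ : ℝ)| := by
        gcongr; exact le_abs_self L
    _ ≤ |L| * τ := by gcongr

/-- The h-set with tail `N × Ω_L`. -/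
def withLipTail {m : ℕ} (τ : ℝ≥0) (d : ℕ) (L : ℝ) (N : HSet m) : HSetTail m (TailSpace τ d) where
  head := N
  tail := lipTail τ d L
  isClosed_tail := isClosed_lipTail τ d L
  convex_tail := convex_lipTail τ d L
  isBounded_tail := isBounded_lipTail τ d L

/-! ### The DDE `u'(t) = f(u(t)) + ε g(u(t - τ))` -/

/-- The segment `u_t(s) = u(t + s)`, `s ∈ [-τ, 0]`. -/
def segmentAt {d : ℕ} (τ : ℝ≥0) (u : C(ℝ, Fin d → ℝ)) (t : ℝ) : Phase τ d :=
  ⟨fun s => u (t + s), by fun_prop⟩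

/-- `u` solves the delay equation for `t ≥ 0` (with the right derivative at `0`) with initial
function `φ` on `[-τ, 0]`; the values of `u` on `(-∞, -τ)` play no role. -/
def IsDDESolution {d : ℕ} (f g : (Fin d → ℝ) → (Fin d → ℝ)) (τ : ℝ≥0) (ε : ℝ)
    (φ : Phase τ d) (u : C(ℝ, Fin d → ℝ)) : Prop :=
  segmentAt τ u 0 = φ ∧
  ∀ t : ℝ, 0 ≤ t → HasDerivWithinAt u (f (u t) + ε • g (u (t - τ))) (Ici 0) t

open Classical in
/-- The semiflow `φ_ε(t, φ) = u_t`, for `t ≥ 0` (solutions exist globally and are unique on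
`[-τ, ∞)` for bounded Lipschitz `f`, `g`). -/
def ddeSemiflow {d : ℕ} (f g : (Fin d → ℝ) → (Fin d → ℝ)) {τ : ℝ≥0} (ε : ℝ) (t : ℝ)
    (φ : Phase τ d) : Phase τ d :=
  if h : ∃ u, IsDDESolution f g τ ε φ u then segmentAt τ h.choose t else φ

/-- `t` is a time at which the trajectory of `φ` is on the section `{ψ : ψ(0) ∈ S}`, within
`η` of the return time of `φ(0)` for the ODE. -/
def IsNearCrossing {d : ℕ} (f g : (Fin d → ℝ) → (Fin d → ℝ)) {τ : ℝ≥0} (ε : ℝ)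
    (S : Set (Fin d → ℝ)) (η : ℝ) (φ : Phase τ d) (t : ℝ) : Prop :=
  t ∈ Icc (odeReturnTime f S (φ (zeroPt τ)) - η) (odeReturnTime f S (φ (zeroPt τ)) + η) ∧
  ddeSemiflow f g ε t φ (zeroPt τ) ∈ S

/-- The return time of the delay equation, the (unique) crossing time in the window
`t_P(φ(0)) + [-η, η]`. -/
def ddeReturnTime {d : ℕ} (f g : (Fin d → ℝ) → (Fin d → ℝ)) {τ : ℝ≥0} (ε : ℝ)
    (S : Set (Fin d → ℝ)) (η : ℝ) (φ : Phase τ d) : ℝ :=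
  sInf {t | IsNearCrossing f g ε S η φ t}

/-- The Poincaré map of the delay equation on the section `{φ : φ(0) ∈ S}`. -/
def ddePoincare {d : ℕ} (f g : (Fin d → ℝ) → (Fin d → ℝ)) {τ : ℝ≥0} (ε : ℝ)
    (S : Set (Fin d → ℝ)) (η : ℝ) (φ : Phase τ d) : Phase τ d :=
  ddeSemiflow f g ε (ddeReturnTime f g ε S η φ) φ

/-- The Poincaré map of the delay equation in the coordinates `φ ↦ (κ(φ(0)), φ - φ(0))` of the
section `{φ : φ(0) ∈ S}`. -/
def ddePoincareCoord {d m : ℕ} (f g : (Fin d → ℝ) → (Fin d → ℝ)) (τ : ℝ≥0) (ε : ℝ)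
    {S : Set (Fin d → ℝ)} (η : ℝ) (κ : SectionChart S m)
    (x : (ℝ × (Fin m → ℝ)) × TailSpace τ d) : (ℝ × (Fin m → ℝ)) × TailSpace τ d :=
  (κ.toFun (ddePoincare f g ε S η (glue (κ.invFun x.1) x.2) (zeroPt τ)),
    tailOf (ddePoincare f g ε S η (glue (κ.invFun x.1) x.2)))

end DelayPerturb

end

noncomputable section

namespace DelayPerturb

open Filter

/-! ### Global solutions of bounded Lipschitz equations -/

section ODE

variable {E : Type*} [NormedAddCommGroup E] [NormedSpace ℝ E]

/-! For small `ε` the Poincaré map of the delay equation is uniformly close to that of the ODE, and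
a covering relation tolerates a small perturbation. By Gronwall (`dist_le_of_forcing`) the term `ε
g` displaces solutions by `O(|ε|)` on bounded time intervals. Since `g` is bounded, this is uniform
in the initial function: whatever the history, `u(t)` follows `Φ(t, φ(0))`. Near the return time
`∇α·f ≥ a` dominates the perturbation on a compact part of the flow box, so `α` increases along `u`,
which therefore meets `S` exactly once in the window (`eventually_window`), at a point close to
`P(φ(0))` (`eventually_dist_ddePoincare_lt`).

The infinite-dimensional factor is harmless. The right-hand side is bounded by `M_f + |ε| M_g`, so
tails with this Lipschitz constant are mapped to such tails. They form a compact convex set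
containing `0`, hence continuous maps on `|N| × Ω` are automatically compact, and the tail can be
contracted linearly to `0` while the head follows the given homotopy with a correction that fades
out (`HSet.Covers.exists_withLipTail`).

`P` is not assumed continuous. The covering relations supply continuity on the supports, and this
passes to the return time (`continuousOn_odeReturnTime`), which makes all estimates uniform there.
The first-return statement needs more: if `P` is continuous on its whole domain, orbits avoid the
closure of `S` before returning (`odeFlow_notMem_closure`), and by compactness nearby delayed
trajectories avoid it too. -/

theorem exists_global_solution [CompleteSpace E] {F : ℝ → E → E} {K B : ℝ≥0}
    (hK : ∀ t, LipschitzWith K (F t)) (hc : ∀ x, Continuous fun t => F t x)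
    (hB : ∀ t x, ‖F t x‖ ≤ B) (x₀ : E) :
    ∃ u : ℝ → E, u 0 = x₀ ∧ ∀ t, HasDerivAt u (F t (u t)) t := by
  have key : ∀ n : ℕ, ∃ α : ℝ → E, α 0 = x₀ ∧
      ∀ t ∈ Ioo (-((n : ℝ) + 1)) (n + 1), HasDerivAt α (F t (α t)) t := by
    intro n
    have h0 : (0 : ℝ) ∈ Icc (-((n : ℝ) + 1)) (n + 1) := by
      constructor <;> linarith [(Nat.cast_nonneg n : (0 : ℝ) ≤ n)]
    -- As `‖F‖ ≤ B`, the ball of radius `B (n + 1)` cannot be left before time `n + 1`, so the local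
    -- theorem applies on the whole interval.
    have hPL : IsPicardLindelof F (⟨0, h0⟩ : Icc (-((n : ℝ) + 1)) (n + 1)) x₀
        (B * ((n : ℝ≥0) + 1)) 0 B K :=
      { lipschitzOnWith := fun t _ => (hK t).lipschitzOnWith
        continuousOn := fun x _ => (hc x).continuousOn
        norm_le := fun t _ x _ => hB t x
        mul_max_le := by simp }
    obtain ⟨α, h1, h2⟩ := hPL.exists_eq_forall_mem_Icc_hasDerivWithinAt₀
    exact ⟨α, h1, fun t ht => (h2 t (Ioo_subset_Icc_self ht)).hasDerivAt (Icc_mem_nhds ht.1 ht.2)⟩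
  choose α h0 hα using key
  have hmono : ∀ n k : ℕ, n ≤ k → EqOn (α n) (α k) (Ioo (-((n : ℝ) + 1)) (n + 1)) := by
    intro n k hnk
    have hnk' : (n : ℝ) ≤ k := by exact_mod_cast hnk
    have hn : (0 : ℝ) ≤ n := Nat.cast_nonneg n
    refine ODE_solution_unique_of_mem_Ioo (v := F) (s := fun _ => univ) (t₀ := 0)
      (fun t _ => (hK t).lipschitzOnWith) ⟨by linarith, by linarith⟩
      (fun t ht => ⟨hα n t ht, mem_univ _⟩)
      (fun t ht => ⟨hα k t ⟨by linarith [ht.1], by linarith [ht.2]⟩, mem_univ _⟩) ?_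
    rw [h0, h0]
  -- Since `α n` solves on the open interval of radius `n + 1`, it covers every `t` with `⌈|t|⌉₊ =
  -- n`. On a neighbourhood of such a `t` the index is at most `n + 1`, so the glued function equals
  -- `α (n + 1)` there.
  refine ⟨fun t => α ⌈|t|⌉₊ t, by simp [h0], fun t => ?_⟩
  set n := ⌈|t|⌉₊ with hn
  have hu : ∀ s, |s| < (n : ℝ) + 1 → α ⌈|s|⌉₊ s = α (n + 1) s := by
    intro s hs
    refine hmono _ _ ?_ (abs_lt.1 ((Nat.le_ceil |s|).trans_lt (lt_add_one _)))
    rw [Nat.ceil_le]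
    push_cast
    exact hs.le
  have ht : |t| < (n : ℝ) + 1 := (Nat.le_ceil |t|).trans_lt (lt_add_one _)
  have hd := hα (n + 1) t (abs_lt.1 (by push_cast; linarith))
  have hev : (fun s => α ⌈|s|⌉₊ s) =ᶠ[𝓝 t] α (n + 1) := by
    filter_upwards [(isOpen_lt continuous_abs continuous_const).mem_nhds ht] with s hs
    exact hu s hs
  have h := hd.congr_of_eventuallyEq hev
  rwa [← hu t ht] at h

theorem gronwallBound_le {D K c x T : ℝ} (hD : 0 ≤ D) (hK : 0 < K) (hc : 0 ≤ c) (hx : x ≤ T) :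
    gronwallBound D K c x ≤ (D + c / K) * Real.exp (K * T) := by
  rw [gronwallBound_of_K_ne_0 hK.ne']
  have h1 : Real.exp (K * x) ≤ Real.exp (K * T) := by gcongr
  have h2 : 0 ≤ c / K := by positivity
  calc D * Real.exp (K * x) + c / K * (Real.exp (K * x) - 1)
      ≤ D * Real.exp (K * T) + c / K * Real.exp (K * T) := by gcongr; linarith
    _ = _ := by ring

/-- Two solutions of `u' = f(u)` with forcing terms that differ by at most `c` stay close. -/
theorem dist_le_of_forcing {f : E → E} {K : ℝ≥0} (hK : 0 < K) (hf : LipschitzWith K f)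
    {u v p q : ℝ → E} {D c T : ℝ} (hc : 0 ≤ c)
    (hu : ∀ t, 0 ≤ t → HasDerivWithinAt u (f (u t) + p t) (Ici 0) t)
    (hv : ∀ t, 0 ≤ t → HasDerivWithinAt v (f (v t) + q t) (Ici 0) t)
    (hpq : ∀ t ∈ Ico 0 T, dist (p t) (q t) ≤ c) (h0 : dist (u 0) (v 0) ≤ D) :
    ∀ t ∈ Icc 0 T, dist (u t) (v t) ≤ (D + c / K) * Real.exp (K * T) := by
  intro t ht
  have hmono : ∀ t ∈ Ico 0 T, Ici t ⊆ Ici (0 : ℝ) := fun t ht => Ici_subset_Ici.2 ht.1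
  -- For the field `f + q(t)` the function `v` is an exact solution and `u` an approximate one with
  -- error `c`.
  have := dist_le_of_approx_trajectories_ODE (v := fun t x => f x + q t) (K := K)
    (f := u) (g := v) (f' := fun t => f (u t) + p t) (g' := fun t => f (v t) + q t)
    (a := 0) (b := T) (εf := c) (εg := 0) (δ := D)
    (fun t => by simpa using hf.add (LipschitzWith.const (q t)))
    (fun t ht => ((hu t ht.1).mono Icc_subset_Ici_self).continuousWithinAt)
    (fun t ht => (hu t ht.1).mono (hmono t ht))
    (fun t ht => by simpa using hpq t ht)
    (fun t ht => ((hv t ht.1).mono Icc_subset_Ici_self).continuousWithinAt)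
    (fun t ht => (hv t ht.1).mono (hmono t ht))
    (fun t ht => by simp) h0 t ht
  refine this.trans ?_
  rw [add_zero, sub_zero]
  exact gronwallBound_le (dist_nonneg.trans h0) (by exact_mod_cast hK) hc ht.2

end ODE

/-! ### The flow of `u' = f(u)` -/

section Flow

variable {d : ℕ} {f : (Fin d → ℝ) → (Fin d → ℝ)} {M : ℝ} {L : ℝ≥0}

theorem odeFlow_exists (hf : BoundedLipschitz f M L) (x : Fin d → ℝ) :
    ∃ u : ℝ → (Fin d → ℝ), u 0 = x ∧ ∀ s, HasDerivAt u (f (u s)) s :=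
  exists_global_solution (F := fun _ => f) (B := ⟨M, hf.bound_pos.le⟩) (fun _ => hf.lip)
    (fun _ => continuous_const) (fun _ => hf.bound) x

theorem odeFlow_zero (hf : BoundedLipschitz f M L) (x : Fin d → ℝ) : odeFlow f 0 x = x := by
  rw [odeFlow, dif_pos (odeFlow_exists hf x)]
  exact (odeFlow_exists hf x).choose_spec.1

theorem hasDerivAt_odeFlow (hf : BoundedLipschitz f M L) (x : Fin d → ℝ) (t : ℝ) :
    HasDerivAt (fun s => odeFlow f s x) (f (odeFlow f t x)) t := by
  have h := (odeFlow_exists hf x).choose_spec.2 t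
  simpa only [odeFlow, dif_pos (odeFlow_exists hf x)] using h

theorem odeFlow_add (hf : BoundedLipschitz f M L) (s t : ℝ) (x : Fin d → ℝ) :
    odeFlow f (s + t) x = odeFlow f s (odeFlow f t x) := by
  have h := ODE_solution_unique_univ (v := fun _ => f) (s := fun _ => univ) (t₀ := 0)
    (f := fun s => odeFlow f (s + t) x) (g := fun s => odeFlow f s (odeFlow f t x)) (K := L)
    (fun _ => hf.lip.lipschitzOnWith)
    (fun r => ⟨(hasDerivAt_odeFlow hf x (r + t)).comp_add_const r t, mem_univ _⟩)
    (fun r => ⟨hasDerivAt_odeFlow hf _ r, mem_univ _⟩)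
    (by simp [odeFlow_zero hf])
  exact congrFun h s

theorem odeFlow_neg_flow (hf : BoundedLipschitz f M L) (t : ℝ) (x : Fin d → ℝ) :
    odeFlow f (-t) (odeFlow f t x) = x := by
  rw [← odeFlow_add hf, neg_add_cancel, odeFlow_zero hf]

theorem dist_odeFlow_time_le (hf : BoundedLipschitz f M L) (s t : ℝ) (x : Fin d → ℝ) :
    dist (odeFlow f s x) (odeFlow f t x) ≤ M * |s - t| := by
  have := Convex.norm_image_sub_le_of_norm_hasDerivWithin_le (f := fun s => odeFlow f s x)
    (f' := fun s => f (odeFlow f s x)) (s := univ) (C := M)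
    (fun r _ => (hasDerivAt_odeFlow hf x r).hasDerivWithinAt) (fun r _ => hf.bound _)
    convex_univ (mem_univ t) (mem_univ s)
  simpa [dist_eq_norm] using this

theorem dist_odeFlow_le (hf : BoundedLipschitz f M L) {t T : ℝ} (ht : |t| ≤ T)
    (x y : Fin d → ℝ) :
    dist (odeFlow f t x) (odeFlow f t y) ≤ dist x y * Real.exp (L * T) := by
  rcases le_total 0 t with h | h
  · have := dist_le_of_forcing (u := fun s => odeFlow f s x) (v := fun s => odeFlow f s y)
      (p := 0) (q := 0) (D := dist x y) (c := 0) (T := T) hf.lip_pos hf.lip le_rfl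
      (fun s _ => by simpa using (hasDerivAt_odeFlow hf x s).hasDerivWithinAt)
      (fun s _ => by simpa using (hasDerivAt_odeFlow hf y s).hasDerivWithinAt)
      (by simp) (by simp [odeFlow_zero hf]) t ⟨h, by rwa [abs_of_nonneg h] at ht⟩
    simpa using this
  -- Backward in time: reversing the flow replaces `f` by `-f`, which has the same Lipschitz
  -- constant.
  · have hneg : ∀ z s, HasDerivAt (fun s => odeFlow f (-s) z) (-f (odeFlow f (-s) z)) s := by
      intro z s
      simpa [Function.comp_def] using (hasDerivAt_odeFlow hf z (-s)).scomp s (hasDerivAt_neg s)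
    have := dist_le_of_forcing (u := fun s => odeFlow f (-s) x) (v := fun s => odeFlow f (-s) y)
      (f := fun z => -f z)
      (p := 0) (q := 0) (D := dist x y) (c := 0) (T := T) hf.lip_pos hf.lip.neg le_rfl
      (fun s _ => by simpa using (hneg x s).hasDerivWithinAt)
      (fun s _ => by simpa using (hneg y s).hasDerivWithinAt)
      (by simp) (by simp [odeFlow_zero hf]) (-t) ⟨by linarith, by rwa [abs_of_nonpos h] at ht⟩
    simpa using this

theorem continuous_odeFlow (hf : BoundedLipschitz f M L) :
    Continuous fun p : ℝ × (Fin d → ℝ) => odeFlow f p.1 p.2 := by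
  rw [continuous_iff_continuousAt]
  rintro ⟨t, x⟩
  rw [ContinuousAt, tendsto_iff_dist_tendsto_zero]
  have hlim : Tendsto (fun p : ℝ × (Fin d → ℝ) =>
      dist p.2 x * Real.exp (L * (|t| + 1)) + M * |p.1 - t|) (𝓝 (t, x)) (𝓝 0) := by
    have : Continuous fun p : ℝ × (Fin d → ℝ) =>
      dist p.2 x * Real.exp (L * (|t| + 1)) + M * |p.1 - t| := by fun_prop
    simpa using this.tendsto (t, x)
  refine squeeze_zero' (Eventually.of_forall fun _ => dist_nonneg) ?_ hlim
  have hev : ∀ᶠ p : ℝ × (Fin d → ℝ) in 𝓝 (t, x), |p.1| < |t| + 1 :=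
    (continuous_fst.abs.tendsto (t, x)).eventually (gt_mem_nhds (lt_add_one _))
  filter_upwards [hev] with p hp
  exact (dist_triangle _ (odeFlow f p.1 x) _).trans
    (add_le_add (dist_odeFlow_le hf hp.le _ _) (dist_odeFlow_time_le hf _ _ _))

end Flow

/-! ### The delay equation -/

section DDE

variable {d : ℕ} {f g : (Fin d → ℝ) → (Fin d → ℝ)} {Mf Mg : ℝ} {Lf Lg : ℝ≥0} {τ : ℝ≥0} {ε : ℝ}

/-- One step of the method of steps: solve with the delayed argument taken from `v`. -/
theorem exists_stepSolution (hf : BoundedLipschitz f Mf Lf) (hg : BoundedLipschitz g Mg Lg)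
    (τ : ℝ≥0) (ε : ℝ) (ψ v : C(ℝ, Fin d → ℝ)) :
    ∃ w : C(ℝ, Fin d → ℝ), (∀ t ≤ 0, w t = ψ t) ∧
      ∀ t, 0 ≤ t → HasDerivWithinAt w (f (w t) + ε • g (v (t - τ))) (Ici 0) t := by
  have hgc : Continuous g := hg.lip.continuous
  obtain ⟨y, hy0, hy⟩ := exists_global_solution (F := fun t x => f x + ε • g (v (t - τ)))
    (K := Lf) (B := ⟨Mf + |ε| * Mg, by have := hf.bound_pos; have := hg.bound_pos; positivity⟩)
    (fun t => by simpa using hf.lip.add (LipschitzWith.const (ε • g (v (t - τ)))))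
    (fun x => by fun_prop)
    (fun t x => by
      refine (norm_add_le _ _).trans (add_le_add (hf.bound _) ?_)
      rw [norm_smul, Real.norm_eq_abs]
      gcongr
      exact hg.bound _) (ψ 0)
  have hyc : Continuous y := continuous_iff_continuousAt.2 fun t => (hy t).continuousAt
  refine ⟨⟨fun t => if t ≤ 0 then ψ t else y t,
    Continuous.if_le ψ.continuous hyc continuous_id continuous_const ?_⟩, ?_, ?_⟩
  · rintro t rfl
    exact hy0.symm
  · intro t ht
    simp [ht]
  · have hEq : ∀ t, 0 ≤ t → (if t ≤ 0 then ψ t else y t) = y t := by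
      intro t ht
      split_ifs with h
      · rw [le_antisymm h ht, hy0]
      · rfl
    intro t ht
    have := (hy t).hasDerivWithinAt (s := Ici 0)
    simp only [ContinuousMap.coe_mk, hEq t ht]
    exact this.congr (fun s hs => hEq s hs) (hEq t ht)

/-- Method of steps. The step map `W` is iterated from an extension `ψ` of `φ`; the iterates `U n`
stabilise on `(-∞, nτ]`, because `W v` up to time `T` depends only on `v` up to `T - τ`. The
solution is the glued limit. -/
theorem exists_isDDESolution (hf : BoundedLipschitz f Mf Lf) (hg : BoundedLipschitz g Mg Lg)
    (hτ : 0 < τ) (ε : ℝ) (φ : Phase τ d) : ∃ u, IsDDESolution f g τ ε φ u := by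
  have hτ' : (0 : ℝ) < τ := by exact_mod_cast hτ
  have hle : -(τ : ℝ) ≤ 0 := by linarith
  let ψ : C(ℝ, Fin d → ℝ) := ⟨fun t => φ (projIcc _ _ hle t), by fun_prop⟩
  choose W hW0 hW using exists_stepSolution hf hg τ ε ψ
  have hcongr : ∀ (v w : C(ℝ, Fin d → ℝ)) (T : ℝ), (∀ t ≤ T - τ, v t = w t) →
      ∀ t ≤ T, W v t = W w t := by
    intro v w T h t ht
    rcases le_or_gt t 0 with h0 | h0
    · rw [hW0 v t h0, hW0 w t h0]
    · have := dist_le_of_forcing (D := 0) (c := 0) (T := T) hf.lip_pos hf.lip le_rfl (hW v) (hW w)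
        (fun s hs => by rw [h (s - τ) (by linarith [hs.2]), dist_self])
        (by rw [hW0 v 0 le_rfl, hW0 w 0 le_rfl, dist_self]) t ⟨h0.le, ht⟩
      simpa using this
  let U : ℕ → C(ℝ, Fin d → ℝ) := fun n => W^[n] ψ
  have hU : ∀ n, U (n + 1) = W (U n) := fun n => Function.iterate_succ_apply' W n ψ
  have hstep : ∀ n : ℕ, ∀ t ≤ (n : ℝ) * τ, U (n + 1) t = U n t := by
    intro n
    induction n with
    | zero =>
      intro t ht
      rw [hU]
      exact hW0 _ t (by simpa using ht)
    | succ n ih =>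
      intro t ht
      rw [hU (n + 1), hU n]
      exact hcongr _ _ ((n + 1 : ℕ) * τ) (fun s hs => by
        rw [← hU n]
        exact ih s (by push_cast at hs; linarith)) t ht
  have hmono : ∀ n k : ℕ, n ≤ k → ∀ t ≤ (n : ℝ) * τ, U k t = U n t := by
    intro n k hnk
    induction k, hnk using Nat.le_induction with
    | base => exact fun _ _ => rfl
    | succ k hnk ih =>
      intro t ht
      have : (n : ℝ) ≤ k := by exact_mod_cast hnk
      rw [hstep k t (ht.trans (by gcongr)), ih t ht]
  let N : ℝ → ℕ := fun t => ⌈t / τ⌉₊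
  have hN : ∀ t, t ≤ N t * τ := fun t => (div_le_iff₀ hτ').1 (Nat.le_ceil _)
  have hNU : ∀ (n : ℕ) (t : ℝ), t ≤ n * τ → U (N t) t = U n t := by
    intro n t ht
    exact (hmono _ _ (Nat.ceil_le.2 ((div_le_iff₀ hτ').2 ht)) t (hN t)).symm
  -- The index `N t + 1` leaves room to the right of `t`, so that a full neighbourhood is covered.
  -- It also makes the local solution `W (U (N t))`, whose delayed argument is read from `U (N t)`,
  -- already stable at `t - τ`.
  have hloc : ∀ t, (fun s => U (N s) s) =ᶠ[𝓝 t] U (N t + 1) := by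
    intro t
    filter_upwards [gt_mem_nhds (show t < (N t + 1 : ℕ) * (τ : ℝ) by
      push_cast; linarith [hN t])] with s hs
    exact hNU _ s hs.le
  have hcont : Continuous fun s => U (N s) s := continuous_iff_continuousAt.2 fun t =>
    (U (N t + 1)).continuous.continuousAt.congr (hloc t).symm
  refine ⟨⟨fun s => U (N s) s, hcont⟩, ?_, ?_⟩
  · ext1 s
    have hs : (s : ℝ) ≤ 0 := s.2.2
    change U (N (0 + s)) (0 + s) = φ s
    rw [zero_add, hNU 0 s (by simpa using hs)]
    change φ (projIcc _ _ hle s) = φ s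
    rw [projIcc_val]
  · intro t ht
    change HasDerivWithinAt (fun s => U (N s) s)
      (f (U (N t) t) + ε • g (U (N (t - τ)) (t - τ))) (Ici 0) t
    have h := hW (U (N t)) t ht
    rw [← hU] at h
    rw [hNU (N t + 1) t (by push_cast; linarith [hN t]), hNU (N t) (t - τ) (by linarith [hN t])]
    exact h.congr_of_eventuallyEq ((hloc t).filter_mono nhdsWithin_le_nhds) (hloc t).eq_of_nhds

/-- The solution of the delay equation with initial function `φ`, on `[-τ, ∞)`. -/
def ddeSol (f g : (Fin d → ℝ) → (Fin d → ℝ)) (ε : ℝ) (φ : Phase τ d) : C(ℝ, Fin d → ℝ) :=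
  open Classical in
  if h : ∃ u, IsDDESolution f g τ ε φ u then h.choose else 0

theorem isDDESolution_ddeSol (hf : BoundedLipschitz f Mf Lf) (hg : BoundedLipschitz g Mg Lg)
    (hτ : 0 < τ) (ε : ℝ) (φ : Phase τ d) : IsDDESolution f g τ ε φ (ddeSol f g ε φ) := by
  rw [ddeSol, dif_pos (exists_isDDESolution hf hg hτ ε φ)]
  exact (exists_isDDESolution hf hg hτ ε φ).choose_spec

theorem ddeSemiflow_eq (hf : BoundedLipschitz f Mf Lf) (hg : BoundedLipschitz g Mg Lg)
    (hτ : 0 < τ) (ε t : ℝ) (φ : Phase τ d) :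
    ddeSemiflow f g ε t φ = segmentAt τ (ddeSol f g ε φ) t := by
  rw [ddeSol, ddeSemiflow, dif_pos (exists_isDDESolution hf hg hτ ε φ),
    dif_pos (exists_isDDESolution hf hg hτ ε φ)]

theorem ddeSemiflow_zeroPt (hf : BoundedLipschitz f Mf Lf) (hg : BoundedLipschitz g Mg Lg)
    (hτ : 0 < τ) (ε t : ℝ) (φ : Phase τ d) :
    ddeSemiflow f g ε t φ (zeroPt τ) = ddeSol f g ε φ t := by
  rw [ddeSemiflow_eq hf hg hτ]
  change ddeSol f g ε φ (t + 0) = _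
  rw [add_zero]

variable {φ ψ : Phase τ d} {u v : C(ℝ, Fin d → ℝ)}

theorem IsDDESolution.eq_initial (hu : IsDDESolution f g τ ε φ u) (s : Icc (-(τ : ℝ)) 0) :
    u s = φ s := by
  rw [← hu.1]
  change u s = u (0 + s)
  rw [zero_add]

theorem IsDDESolution.apply_zero (hu : IsDDESolution f g τ ε φ u) : u 0 = φ (zeroPt τ) :=
  hu.eq_initial (zeroPt τ)

theorem IsDDESolution.hasDerivAt (hu : IsDDESolution f g τ ε φ u) {t : ℝ} (ht : 0 < t) :
    HasDerivAt u (f (u t) + ε • g (u (t - τ))) t :=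
  (hu.2 t ht.le).hasDerivAt (Ici_mem_nhds ht)

theorem norm_smul_le_of_bound (hg : BoundedLipschitz g Mg Lg) (ε : ℝ) (x : Fin d → ℝ) :
    ‖ε • g x‖ ≤ |ε| * Mg := by
  rw [norm_smul, Real.norm_eq_abs]
  gcongr
  exact hg.bound _

/-- The solutions of the delay equation are uniformly close to those of the unperturbed one. -/
theorem IsDDESolution.dist_odeFlow_le (hf : BoundedLipschitz f Mf Lf)
    (hg : BoundedLipschitz g Mg Lg) (hu : IsDDESolution f g τ ε φ u) {t T : ℝ}
    (ht : t ∈ Icc 0 T) :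
    dist (u t) (odeFlow f t (φ (zeroPt τ))) ≤ |ε| * (Mg / Lf * Real.exp (Lf * T)) := by
  have hMg := hg.bound_pos
  have := dist_le_of_forcing (v := fun s => odeFlow f s (φ (zeroPt τ))) (q := 0) (D := 0)
    (c := |ε| * Mg) (T := T) hf.lip_pos hf.lip (by positivity) hu.2
    (fun s _ => by simpa using (hasDerivAt_odeFlow hf _ s).hasDerivWithinAt)
    (fun s _ => by simpa using norm_smul_le_of_bound hg ε _)
    (by rw [odeFlow_zero hf, hu.apply_zero, dist_self]) t ht
  refine this.trans_eq ?_
  ring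

/-- Lipschitz dependence on the initial function, over a finite number of delay intervals. -/
theorem exists_dist_le_mul (hf : BoundedLipschitz f Mf Lf) (hg : BoundedLipschitz g Mg Lg)
    (τ : ℝ≥0) (ε : ℝ) (n : ℕ) :
    ∃ A : ℝ, 0 ≤ A ∧ ∀ (φ ψ : Phase τ d) (u v : C(ℝ, Fin d → ℝ)),
      IsDDESolution f g τ ε φ u → IsDDESolution f g τ ε ψ v →
      ∀ t ∈ Icc (-(τ : ℝ)) (n * τ), dist (u t) (v t) ≤ A * dist φ ψ := by
  have hinit : ∀ (φ ψ : Phase τ d) (u v : C(ℝ, Fin d → ℝ)),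
      IsDDESolution f g τ ε φ u → IsDDESolution f g τ ε ψ v →
      ∀ t ∈ Icc (-(τ : ℝ)) 0, dist (u t) (v t) ≤ dist φ ψ := by
    intro φ ψ u v hu hv t ht
    rw [hu.eq_initial ⟨t, ht⟩, hv.eq_initial ⟨t, ht⟩]
    exact ContinuousMap.dist_apply_le_dist _
  have hL : (0 : ℝ) < Lf := by exact_mod_cast hf.lip_pos
  induction n with
  | zero =>
    refine ⟨1, zero_le_one, fun φ ψ u v hu hv t ht => ?_⟩
    rw [one_mul]
    exact hinit φ ψ u v hu hv t (by simpa using ht)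
  | succ n ih =>
    obtain ⟨A, hA, h⟩ := ih
    -- The summand `1` handles `t ≤ 0`, where the distance is at most `dist φ ψ`. The rest is
    -- Gronwall with forcing error `|ε| Lg A dist φ ψ`, as the delayed values lie in the range of
    -- the induction hypothesis.
    have hA' : 1 ≤ 1 + (1 + |ε| * Lg * A / Lf) * Real.exp (Lf * ((n + 1 : ℕ) * τ)) := by
      have : 0 ≤ (1 + |ε| * Lg * A / Lf) * Real.exp (Lf * ((n + 1 : ℕ) * τ)) := by positivity
      linarith
    refine ⟨1 + (1 + |ε| * Lg * A / Lf) * Real.exp (Lf * ((n + 1 : ℕ) * τ)), by linarith,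
      fun φ ψ u v hu hv t ht => ?_⟩
    rcases le_or_gt t 0 with h0 | h0
    · exact (hinit φ ψ u v hu hv t ⟨ht.1, h0⟩).trans (le_mul_of_one_le_left dist_nonneg hA')
    · have := dist_le_of_forcing (D := dist φ ψ) (c := |ε| * (Lg * (A * dist φ ψ)))
        (T := (n + 1 : ℕ) * τ) hf.lip_pos hf.lip (by positivity) hu.2 hv.2
        (fun s hs => by
          rw [dist_smul₀, Real.norm_eq_abs]
          gcongr
          refine (hg.lip.dist_le_mul _ _).trans ?_
          gcongr
          refine h φ ψ u v hu hv _ ⟨by linarith [hs.1], ?_⟩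
          have := hs.2
          push_cast at this
          linarith)
        (hinit φ ψ u v hu hv 0 ⟨by simp, le_rfl⟩) t ⟨h0.le, ht.2⟩
      refine this.trans ?_
      have e : (dist φ ψ + |ε| * (Lg * (A * dist φ ψ)) / Lf) * Real.exp (Lf * ((n + 1 : ℕ) * τ))
          = (1 + |ε| * Lg * A / Lf) * Real.exp (Lf * ((n + 1 : ℕ) * τ)) * dist φ ψ := by ring
      rw [e]
      gcongr
      linarith

theorem continuous_segmentAt (τ : ℝ≥0) (u : C(ℝ, Fin d → ℝ)) : Continuous (segmentAt τ u) := by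
  refine ContinuousMap.continuous_of_continuous_uncurry _ ?_
  change Continuous fun p : ℝ × Icc (-(τ : ℝ)) 0 => u (p.1 + p.2)
  fun_prop

/-- The change of initial function at equal times is controlled by the Lipschitz estimate; the
change of time then concerns one fixed continuous solution. -/
theorem continuousOn_ddeSemiflow (hf : BoundedLipschitz f Mf Lf) (hg : BoundedLipschitz g Mg Lg)
    (hτ : 0 < τ) (ε : ℝ) :
    ContinuousOn (fun p : ℝ × Phase τ d => ddeSemiflow f g ε p.1 p.2) (Ici 0 ×ˢ univ) := by
  have hτ' : (0 : ℝ) < τ := by exact_mod_cast hτ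
  rintro ⟨t, φ⟩ -
  obtain ⟨n, hn⟩ : ∃ n : ℕ, t + 1 < n * τ := by
    obtain ⟨n, hn⟩ := exists_nat_gt ((t + 1) / τ)
    exact ⟨n, (div_lt_iff₀ hτ').1 hn⟩
  obtain ⟨A, hA, h⟩ := exists_dist_le_mul hf hg τ ε n
  simp only [ddeSemiflow_eq hf hg hτ]
  rw [ContinuousWithinAt, tendsto_iff_dist_tendsto_zero]
  have hlim : Tendsto (fun p : ℝ × Phase τ d => A * dist p.2 φ +
      dist (segmentAt τ (ddeSol f g ε φ) p.1) (segmentAt τ (ddeSol f g ε φ) t))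
      (𝓝[Ici 0 ×ˢ univ] (t, φ)) (𝓝 0) := by
    have hs := continuous_segmentAt τ (ddeSol f g ε φ)
    have : Continuous fun p : ℝ × Phase τ d => A * dist p.2 φ +
      dist (segmentAt τ (ddeSol f g ε φ) p.1) (segmentAt τ (ddeSol f g ε φ) t) := by fun_prop
    have h := this.tendsto (t, φ)
    simp only [dist_self, mul_zero, add_zero] at h
    exact h.mono_left nhdsWithin_le_nhds
  refine squeeze_zero' (Eventually.of_forall fun _ => dist_nonneg) ?_ hlim
  have hev : ∀ᶠ p : ℝ × Phase τ d in 𝓝[Ici 0 ×ˢ univ] (t, φ), p.1 < t + 1 :=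
    ((continuous_fst.tendsto (t, φ)).eventually (gt_mem_nhds (lt_add_one _))).filter_mono
      nhdsWithin_le_nhds
  filter_upwards [hev, self_mem_nhdsWithin] with p hp hp0
  refine (dist_triangle _ (segmentAt τ (ddeSol f g ε φ) p.1) _).trans (add_le_add_left ?_ _)
  rw [ContinuousMap.dist_le (by positivity)]
  intro s
  have hs1 : -(τ : ℝ) ≤ s := s.2.1
  have hs2 : (s : ℝ) ≤ 0 := s.2.2
  have hp1 : (0 : ℝ) ≤ p.1 := hp0.1
  exact h _ _ _ _ (isDDESolution_ddeSol hf hg hτ ε p.2) (isDDESolution_ddeSol hf hg hτ ε φ) _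
    ⟨by linarith, by linarith⟩

theorem continuousOn_ddeSol (hf : BoundedLipschitz f Mf Lf) (hg : BoundedLipschitz g Mg Lg)
    (hτ : 0 < τ) (ε : ℝ) :
    ContinuousOn (fun p : ℝ × Phase τ d => ddeSol f g ε p.2 p.1) (Ici 0 ×ˢ univ) := by
  simp only [← ddeSemiflow_zeroPt hf hg hτ]
  exact (continuous_eval_const (zeroPt τ)).comp_continuousOn
    (continuousOn_ddeSemiflow hf hg hτ ε)

/-- A solution with `(M_f + |ε| M_g)`-Lipschitz initial function keeps this Lipschitz constant. -/
theorem IsDDESolution.norm_sub_le (hf : BoundedLipschitz f Mf Lf) (hg : BoundedLipschitz g Mg Lg)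
    (hu : IsDDESolution f g τ ε φ u)
    (hφ : ∀ s t : Icc (-(τ : ℝ)) 0, ‖φ t - φ s‖ ≤ (Mf + |ε| * Mg) * |(t : ℝ) - s|)
    {s t : ℝ} (hs : -(τ : ℝ) ≤ s) (hst : s ≤ t) :
    ‖u t - u s‖ ≤ (Mf + |ε| * Mg) * (t - s) := by
  have hpos : ∀ s t : ℝ, 0 ≤ s → s ≤ t → ‖u t - u s‖ ≤ (Mf + |ε| * Mg) * (t - s) := by
    intro s t hs hst
    have := Convex.norm_image_sub_le_of_norm_hasDerivWithin_le (f := u)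
      (f' := fun s => f (u s) + ε • g (u (s - τ))) (s := Ici 0) (C := Mf + |ε| * Mg)
      (fun r hr => hu.2 r hr)
      (fun r _ => (norm_add_le _ _).trans
        (add_le_add (hf.bound _) (norm_smul_le_of_bound hg ε _)))
      (convex_Ici 0) (mem_Ici.2 hs) (mem_Ici.2 (hs.trans hst))
    rwa [Real.norm_of_nonneg (sub_nonneg.2 hst)] at this
  have hneg : ∀ s t : ℝ, -(τ : ℝ) ≤ s → s ≤ t → t ≤ 0 →
      ‖u t - u s‖ ≤ (Mf + |ε| * Mg) * (t - s) := by
    intro s t hs hst ht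
    have h := hφ ⟨s, hs, hst.trans ht⟩ ⟨t, hs.trans hst, ht⟩
    rw [← hu.eq_initial, ← hu.eq_initial] at h
    rwa [abs_of_nonneg (sub_nonneg.2 hst)] at h
  rcases le_total 0 s with h0 | h0
  · exact hpos s t h0 hst
  rcases le_total t 0 with h1 | h1
  · exact hneg s t hs hst h1
  calc ‖u t - u s‖ = ‖(u t - u 0) + (u 0 - u s)‖ := by congr 1; abel
    _ ≤ (Mf + |ε| * Mg) * (t - 0) + (Mf + |ε| * Mg) * (0 - s) :=
      (norm_add_le _ _).trans (add_le_add (hpos 0 t le_rfl h1) (hneg s 0 hs h0 le_rfl))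
    _ = _ := by ring

/-- This invariance dictates the Lipschitz constant of the tails: it bounds the speed of every
solution, so it holds across the junction at time `0`, and subtracting the value at `0` does not
affect increments. -/
theorem tailOf_ddeSemiflow_mem_lipTail (hf : BoundedLipschitz f Mf Lf)
    (hg : BoundedLipschitz g Mg Lg) (hτ : 0 < τ) {t : ℝ} (ht : 0 ≤ t) (x : Fin d → ℝ)
    {η : TailSpace τ d} (hη : η ∈ lipTail τ d (Mf + |ε| * Mg)) :
    tailOf (ddeSemiflow f g ε t (glue x η)) ∈ lipTail τ d (Mf + |ε| * Mg) := by
  rw [ddeSemiflow_eq hf hg hτ]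
  have hu := isDDESolution_ddeSol hf hg hτ ε (glue x η)
  set u := ddeSol f g ε (glue x η)
  have hlip : ∀ s t : Icc (-(τ : ℝ)) 0,
      ‖(glue x η) t - (glue x η) s‖ ≤ (Mf + |ε| * Mg) * |(t : ℝ) - s| := by
    intro s t
    have := hη s t
    simpa [glue] using this
  have key : ∀ r s : Icc (-(τ : ℝ)) 0, (r : ℝ) ≤ s →
      ‖u (t + s) - u (t + r)‖ ≤ (Mf + |ε| * Mg) * |(s : ℝ) - r| := by
    intro r s hrs
    have hr : -(τ : ℝ) ≤ r := r.2.1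
    rw [abs_of_nonneg (sub_nonneg.2 hrs)]
    convert hu.norm_sub_le hf hg hlip (s := t + r) (t := t + s) (by linarith) (by linarith) using 1
    ring
  intro r s
  change ‖(u (t + s) - u (t + 0)) - (u (t + r) - u (t + 0))‖ ≤ _
  rw [sub_sub_sub_cancel_right]
  rcases le_total (r : ℝ) s with h | h
  · exact key r s h
  · rw [norm_sub_rev, abs_sub_comm]
    exact key s r h

end DDE

/-! ### Compactness of the tails -/

/-- Arzelà–Ascoli: a common Lipschitz constant gives equicontinuity, and vanishing at `0` gives
boundedness. -/
theorem isCompact_lipTail (τ : ℝ≥0) (d : ℕ) {L : ℝ} (hL : 0 ≤ L) :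
    IsCompact (lipTail τ d L) := by
  rw [(IsEmbedding.subtypeVal : IsEmbedding (Subtype.val : TailSpace τ d → Phase τ d)).isCompact_iff]
  have hlip : ∀ η ∈ lipTail τ d L, LipschitzWith ⟨L, hL⟩ (η : Phase τ d) := fun η hη =>
    LipschitzWith.of_dist_le_mul fun s t => by
      rw [dist_eq_norm, Subtype.dist_eq, Real.dist_eq]
      exact hη t s
  obtain ⟨R, hR⟩ := isBounded_iff_forall_norm_le.1 (isBounded_lipTail τ d L)
  refine ArzelaAscoli.isCompact_of_equicontinuous _ ?_ ?_
  · have hcompact : IsCompact (univ.pi fun _ => Metric.closedBall 0 R :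
        Set (Icc (-(τ : ℝ)) 0 → Fin d → ℝ)) :=
      isCompact_univ_pi fun _ => isCompact_closedBall _ _
    refine hcompact.of_isClosed_subset ?_ ?_
    -- The Lipschitz condition already implies continuity, so the set is cut out of all functions by
    -- pointwise closed conditions.
    · have e : ContinuousMap.toFun '' (Subtype.val '' lipTail τ d L : Set (Phase τ d)) =
          {h | h (zeroPt τ) = 0} ∩ {h | ∀ s t : Icc (-(τ : ℝ)) 0, ‖h t - h s‖ ≤ L * |(t : ℝ) - s|} := by
        ext h
        constructor
        · rintro ⟨_, ⟨η, hη, rfl⟩, rfl⟩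
          exact ⟨η.2, hη⟩
        · rintro ⟨h0, h1⟩
          have hl : LipschitzWith ⟨L, hL⟩ h := LipschitzWith.of_dist_le_mul fun s t => by
            rw [dist_eq_norm, Subtype.dist_eq, Real.dist_eq]
            exact h1 t s
          exact ⟨⟨h, hl.continuous⟩, ⟨⟨⟨h, hl.continuous⟩, h0⟩, h1, rfl⟩, rfl⟩
      rw [e]
      refine (isClosed_eq (continuous_apply _) continuous_const).inter ?_
      simp only [ofPred_forall]
      exact isClosed_iInter fun s => isClosed_iInter fun t =>
        isClosed_le (by fun_prop) continuous_const
    · rintro _ ⟨_, ⟨η, hη, rfl⟩, rfl⟩ s -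
      rw [mem_closedBall_zero_iff]
      exact ((η : Phase τ d).norm_coe_le_norm s).trans (hR η hη)
  · refine (LipschitzWith.uniformEquicontinuous _ ⟨L, hL⟩ ?_).equicontinuous
    rintro ⟨_, ⟨η, hη, rfl⟩⟩
    exact hlip η hη

theorem continuous_tailOf {τ : ℝ≥0} {d : ℕ} : Continuous (tailOf : Phase τ d → TailSpace τ d) := by
  refine Continuous.subtype_mk (continuous_id.sub ?_) _
  exact ContinuousMap.continuous_const'.comp (continuous_eval_const (zeroPt τ))

theorem continuous_glue {τ : ℝ≥0} {d : ℕ} :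
    Continuous fun p : (Fin d → ℝ) × TailSpace τ d => glue p.1 p.2 :=
  (ContinuousMap.continuous_const'.comp continuous_fst).add
    (continuous_subtype_val.comp continuous_snd)

theorem glue_zeroPt {τ : ℝ≥0} {d : ℕ} (x : Fin d → ℝ) (η : TailSpace τ d) :
    glue x η (zeroPt τ) = x := by
  have h : (η : Phase τ d) (zeroPt τ) = 0 := η.2
  simp [glue, h]

/-! ### Sections and return times of the flow -/

section Section

variable {d : ℕ} {f : (Fin d → ℝ) → (Fin d → ℝ)} {M : ℝ} {L : ℝ≥0}
  {S D : Set (Fin d → ℝ)} {δ a : ℝ} {α : (Fin d → ℝ) → ℝ} {u : Fin d → ℝ}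

theorem IsSection.flow_mem_box (_hS : IsSection f S δ α a) (hu : u ∈ S) {t : ℝ} (ht : |t| < δ) :
    odeFlow f t u ∈ flowBox f S δ :=
  ⟨(t, u), ⟨abs_lt.1 ht, hu⟩, rfl⟩

theorem IsSection.eq_zero (hS : IsSection f S δ α a) (hu : u ∈ S) : α u = 0 := by
  rw [hS.zero_set] at hu
  exact hu.2

theorem IsSection.mem_of_eq_zero (hS : IsSection f S δ α a) (hu : u ∈ flowBox f S δ)
    (h : α u = 0) : u ∈ S := by
  rw [hS.zero_set]
  exact ⟨hu, h⟩

theorem IsSection.flow_notMem (hS : IsSection f S δ α a) (hu : u ∈ S) {t : ℝ}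
    (ht : t ∈ Ioo 0 δ) : odeFlow f t u ∉ S :=
  fun h => (hS.pos_after t ht u hu).ne' (hS.eq_zero h)

theorem IsSection.isOpen_pos (hS : IsSection f S δ α a) :
    IsOpen (flowBox f S δ ∩ α ⁻¹' Ioi 0) :=
  hS.contDiff.continuousOn.isOpen_inter_preimage hS.isOpen_box isOpen_Ioi

theorem IsSection.isOpen_neg (hS : IsSection f S δ α a) :
    IsOpen (flowBox f S δ ∩ α ⁻¹' Iio 0) :=
  hS.contDiff.continuousOn.isOpen_inter_preimage hS.isOpen_box isOpen_Iio

/-- `S` need not be closed, so attainment of the infimum comes from transversality: `α > 0` just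
after `S`, hence distinct return times differ by at least `δ`. A return time within `δ` of the
infimum must be the infimum. -/
theorem odeReturnTime_spec (hf : BoundedLipschitz f M L) (hS : IsSection f S δ α a)
    (hD : IsReturnDomain f S D) (hu : u ∈ D) :
    0 < odeReturnTime f S u ∧ odePoincare f S u ∈ S := by
  set R := {t | 0 < t ∧ odeFlow f t u ∈ S} with hR
  have hne : R.Nonempty := hD.returns u hu
  have hbdd : BddBelow R := ⟨0, fun t ht => ht.1.le⟩
  suffices h : sInf R ∈ R from h
  obtain ⟨t, ht, htlt⟩ := exists_lt_of_csInf_lt hne (lt_add_of_pos_right (sInf R) hS.delta_pos)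
  rcases (csInf_le hbdd ht).eq_or_lt with h | h
  · rwa [h]
  · obtain ⟨t', ht', hlt⟩ := exists_lt_of_csInf_lt hne h
    have h' := csInf_le hbdd ht'
    refine absurd ht.2 ?_
    rw [← sub_add_cancel t t', odeFlow_add hf]
    exact hS.flow_notMem ht'.2 ⟨by linarith, by linarith⟩

theorem odeReturnTime_le {t : ℝ} (ht : 0 < t) (h : odeFlow f t u ∈ S) : odeReturnTime f S u ≤ t :=
  csInf_le ⟨0, fun _ hs => hs.1.le⟩ ⟨ht, h⟩

theorem IsReturnDomain.subset (hD : IsReturnDomain f S D) : D ⊆ S := by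
  obtain ⟨O, -, rfl⟩ := hD.relOpen
  exact inter_subset_left

/-- With `η < δ` this keeps the time window `t_P + [-η, η]` inside positive times. -/
theorem le_odeReturnTime (hf : BoundedLipschitz f M L) (hS : IsSection f S δ α a)
    (hD : IsReturnDomain f S D) (hu : u ∈ D) : δ ≤ odeReturnTime f S u := by
  obtain ⟨h0, h1⟩ := odeReturnTime_spec hf hS hD hu
  by_contra! h
  exact hS.flow_notMem (hD.subset hu) ⟨h0, h⟩ h1

/-- Near an orbit that meets the section at time `t₁` all orbits do, at times near `t₁`. -/
theorem IsSection.eventually_exists_crossing (hf : BoundedLipschitz f M L)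
    (hS : IsSection f S δ α a) {t₁ : ℝ} (hu : odeFlow f t₁ u ∈ S) {θ : ℝ} (hθ : 0 < θ) :
    ∀ᶠ v in 𝓝 u, ∃ s, |s - t₁| < θ ∧ odeFlow f s v ∈ S := by
  -- At `t₁ ± r` the orbit of `u` is strictly on the two sides of `S`, and in between it stays in
  -- the open box. Both facts persist for nearby `v`, and the intermediate value theorem gives the
  -- crossing.
  obtain ⟨r, hr0, hr⟩ : ∃ r, 0 < r ∧ r < min θ δ := exists_between (lt_min hθ hS.delta_pos)
  have hrθ : r < θ := hr.trans_le (min_le_left _ _)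
  have hrδ : r < δ := hr.trans_le (min_le_right _ _)
  have hc := continuous_odeFlow hf
  have hc' : ∀ t, Continuous fun v => odeFlow f t v := fun t =>
    hc.comp (continuous_const.prodMk continuous_id)
  have hshift : ∀ s, odeFlow f (t₁ + s) u = odeFlow f s (odeFlow f t₁ u) := fun s => by
    rw [add_comm, odeFlow_add hf]
  have habs : |r| < δ := by rwa [abs_of_pos hr0]
  have habs' : |-r| < δ := by rwa [abs_neg]
  have hpos : ∀ᶠ v in 𝓝 u, odeFlow f (t₁ + r) v ∈ flowBox f S δ ∩ α ⁻¹' Ioi 0 := by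
    refine (hc' _).continuousAt.eventually_mem (hS.isOpen_pos.mem_nhds ?_)
    rw [hshift]
    exact ⟨hS.flow_mem_box hu habs, hS.pos_after r ⟨hr0, hrδ⟩ _ hu⟩
  have hneg : ∀ᶠ v in 𝓝 u, odeFlow f (t₁ + -r) v ∈ flowBox f S δ ∩ α ⁻¹' Iio 0 := by
    refine (hc' _).continuousAt.eventually_mem (hS.isOpen_neg.mem_nhds ?_)
    rw [hshift]
    exact ⟨hS.flow_mem_box hu habs', hS.neg_before (-r) ⟨by linarith, by linarith⟩ _ hu⟩
  have hbox : ∀ᶠ v in 𝓝 u, ∀ s ∈ Icc (t₁ + -r) (t₁ + r), odeFlow f s v ∈ flowBox f S δ := by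
    refine isCompact_Icc.eventually_forall_of_forall_eventually fun s hs => ?_
    refine (hc.comp continuous_swap).continuousAt.eventually_mem (hS.isOpen_box.mem_nhds ?_)
    have e : odeFlow f s u = odeFlow f (s - t₁) (odeFlow f t₁ u) := by
      rw [← hshift, add_sub_cancel]
    change odeFlow f s u ∈ _
    rw [e]
    exact hS.flow_mem_box hu (abs_lt.2 ⟨by linarith [hs.1], by linarith [hs.2]⟩)
  filter_upwards [hpos, hneg, hbox] with v hv1 hv2 hv3
  have hcont : ContinuousOn (fun s => α (odeFlow f s v)) (Icc (t₁ + -r) (t₁ + r)) :=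
    hS.contDiff.continuousOn.comp
      (hc.comp (continuous_id.prodMk continuous_const)).continuousOn hv3
  obtain ⟨s, hs, hs0⟩ := intermediate_value_Icc (by linarith) hcont
    (show (0 : ℝ) ∈ Icc _ _ from ⟨le_of_lt hv2.2, le_of_lt hv1.2⟩)
  exact ⟨s, abs_lt.2 ⟨by linarith [hs.1], by linarith [hs.2]⟩,
    hS.mem_of_eq_zero (hv3 s hs) hs0⟩

/-- The return time is continuous wherever the Poincaré map is. -/
theorem continuousOn_odeReturnTime (hf : BoundedLipschitz f M L) (hS : IsSection f S δ α a)
    (hD : IsReturnDomain f S D) {A : Set (Fin d → ℝ)} (hA : A ⊆ D)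
    (hP : ContinuousOn (odePoincare f S) A) : ContinuousOn (odeReturnTime f S) A := by
  intro u hu
  obtain ⟨hT, hPu⟩ := odeReturnTime_spec hf hS hD (hA hu)
  set T := odeReturnTime f S u with hTdef
  rw [ContinuousWithinAt, Metric.tendsto_nhds]
  intro θ hθ
  -- Upper semicontinuity needs no continuity of `P`: nearby orbits cross near time `T`, and the
  -- tolerance `min θ T` keeps that time positive.
  have hupper : ∀ᶠ v in 𝓝[A] u, odeReturnTime f S v < T + θ := by
    refine (((hS.eventually_exists_crossing hf hPu (lt_min hθ hT))).filter_mono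
      nhdsWithin_le_nhds).mono ?_
    rintro v ⟨s, hs, hsv⟩
    have h := abs_lt.1 hs
    have h1 := min_le_left θ T
    have h2 := min_le_right θ T
    exact (odeReturnTime_le (by linarith [h.1]) hsv).trans_lt (by linarith [h.2])
  have hlower : ∀ᶠ v in 𝓝[A] u, T - θ < odeReturnTime f S v := by
    have hc := continuous_odeFlow hf
    -- By minimality of `T`, `Φ(t, u) ≠ P(u)` on the compact interval `[δ, T - θ]`, and this
    -- persists for pairs near `(u, P(u))`. Continuity of `P` places `(v, P(v))` among them, so `v`
    -- cannot return at such a time.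
    have htube : ∀ᶠ w in 𝓝 (u, odePoincare f S u), ∀ t ∈ Icc δ (T - θ),
        odeFlow f t w.1 ≠ w.2 := by
      refine isCompact_Icc.eventually_forall_of_forall_eventually fun t ht => ?_
      refine ContinuousAt.eventually_ne (g := fun z : ((Fin d → ℝ) × (Fin d → ℝ)) × ℝ =>
        odeFlow f z.2 z.1.1 - z.1.2) (y := 0) ?_ ?_ |>.mono fun z hz => sub_ne_zero.1 hz
      · exact ((hc.comp (continuous_snd.prodMk (continuous_fst.comp continuous_fst))).sub
          (continuous_snd.comp continuous_fst)).continuousAt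
      · refine sub_ne_zero.2 fun h => ?_
        have h' : odeFlow f t u ∈ S := by
          change odeFlow f t u = _ at h
          rwa [h]
        have := odeReturnTime_le (hS.delta_pos.trans_le ht.1) h'
        linarith [ht.2]
    have hlim : Tendsto (fun v => (v, odePoincare f S v)) (𝓝[A] u)
        (𝓝 (u, odePoincare f S u)) :=
      (tendsto_id.mono_left nhdsWithin_le_nhds).prodMk_nhds (hP u hu)
    filter_upwards [hlim.eventually htube, self_mem_nhdsWithin] with v hv hvA
    by_contra! h
    exact hv _ ⟨le_odeReturnTime hf hS hD (hA hvA), h⟩ rfl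
  filter_upwards [hupper, hlower] with v h1 h2
  rw [Real.dist_eq, abs_lt]
  constructor <;> linarith

/-- If the return time is continuous on its domain, orbits avoid the closure of the section until
they return. -/
theorem odeFlow_notMem_closure (hf : BoundedLipschitz f M L) (hS : IsSection f S δ α a)
    (hD : IsReturnDomain f S D) (hcont : ContinuousOn (odeReturnTime f S) D) (hu : u ∈ D)
    {t : ℝ} (ht : 0 < t) (htT : t < odeReturnTime f S u) : odeFlow f t u ∉ closure S := by
  intro hcl
  obtain ⟨O, hO, hDO⟩ := hD.relOpen
  set T := odeReturnTime f S u with hT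
  have hc := continuous_odeFlow hf
  -- A point `w ∈ S` near `Φ(t, u)`, followed backward, meets `S` near `u` at a point of `D`. That
  -- point returns to `S` at `w` after a time close to `t`, below `(t + T) / 2`, against the
  -- continuity of the return time.
  have hev : ∀ᶠ v in 𝓝 u, v ∈ O ∧ (v ∈ D → (t + T) / 2 < odeReturnTime f S v) := by
    have h1 : ∀ᶠ v in 𝓝[D] u, (t + T) / 2 < odeReturnTime f S v :=
      (hcont u hu).eventually (lt_mem_nhds (by linarith))
    rw [hDO] at hu
    exact (hO.eventually_mem hu.2).and (eventually_nhdsWithin_iff.1 h1)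
  have hback : odeFlow f (-t) (odeFlow f t u) = u := odeFlow_neg_flow hf t u
  have htend : Tendsto (fun p : ℝ × (Fin d → ℝ) => odeFlow f p.1 p.2)
      (𝓝 (-t) ×ˢ 𝓝 (odeFlow f t u)) (𝓝 u) := by
    have := hc.tendsto (-t, odeFlow f t u)
    rwa [nhds_prod_eq, hback] at this
  obtain ⟨p, hp, q, hq, hpq⟩ := eventually_prod_iff.1 (htend.eventually hev)
  obtain ⟨θ, hθ, hpθ⟩ := Metric.eventually_nhds_iff.1 hp
  have hcross := hS.eventually_exists_crossing hf (u := odeFlow f t u) (t₁ := -t)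
    (by rw [hback]; exact hD.subset hu) (lt_min hθ (lt_min ht (show 0 < (T - t) / 2 by linarith)))
  obtain ⟨w, hwS, ⟨s, hs, hsw⟩, hqw⟩ :=
    ((mem_closure_iff_frequently.1 hcl).and_eventually (hcross.and hq)).exists
  have hsθ : |s - -t| < θ := hs.trans_le (min_le_left _ _)
  have hst : |s - -t| < t := hs.trans_le ((min_le_right _ _).trans (min_le_left _ _))
  have hsT : |s - -t| < (T - t) / 2 := hs.trans_le ((min_le_right _ _).trans (min_le_right _ _))
  obtain ⟨hvO, hv⟩ := hpq (hpθ (by rwa [Real.dist_eq])) hqw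
  have hvD : odeFlow f s w ∈ D := by
    rw [hDO]
    exact ⟨hsw, hvO⟩
  have h1 := hv hvD
  have h2 : odeReturnTime f S (odeFlow f s w) ≤ -s := by
    refine odeReturnTime_le (by linarith [(abs_lt.1 hst).2]) ?_
    rwa [odeFlow_neg_flow hf]
  linarith [(abs_lt.1 hsT).1]

end Section

/-! ### The return map of the delay equation -/

section Return

variable {d : ℕ} {f g : (Fin d → ℝ) → (Fin d → ℝ)} {Mf Mg : ℝ} {Lf Lg : ℝ≥0} {τ : ℝ≥0}
  {S D A : Set (Fin d → ℝ)} {δ a η : ℝ} {α : (Fin d → ℝ) → ℝ}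

theorem eventually_dist_odeFlow_le (hf : BoundedLipschitz f Mf Lf)
    (hg : BoundedLipschitz g Mg Lg) (τ : ℝ≥0) (T : ℝ) {r : ℝ} (hr : 0 < r) :
    ∀ᶠ ε in 𝓝 (0 : ℝ), ∀ (φ : Phase τ d) (u : C(ℝ, Fin d → ℝ)), IsDDESolution f g τ ε φ u →
      ∀ t ∈ Icc 0 T, dist (u t) (odeFlow f t (φ (zeroPt τ))) ≤ r := by
  have hlim : Tendsto (fun ε : ℝ => |ε| * (Mg / Lf * Real.exp (Lf * T))) (𝓝 0) (𝓝 0) := by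
    have : Continuous fun ε : ℝ => |ε| * (Mg / Lf * Real.exp (Lf * T)) := by fun_prop
    simpa using this.tendsto 0
  filter_upwards [hlim.eventually (ge_mem_nhds hr)] with ε hε φ u hu t ht
  exact (hu.dist_odeFlow_le hf hg ht).trans hε

/-- A compact piece of the flow box around a compact part of the section. -/
theorem IsSection.exists_cthickening_subset (hf : BoundedLipschitz f Mf Lf)
    (hS : IsSection f S δ α a) (hηδ : η < δ) (hA : IsCompact A) (hAS : A ⊆ S) :
    ∃ r > 0, ∃ Q ⊆ flowBox f S δ, IsCompact Q ∧
      ∀ x ∈ A, ∀ t ∈ Icc (-η) η, Metric.closedBall (odeFlow f t x) r ⊆ Q := by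
  set G := (fun p : ℝ × (Fin d → ℝ) => odeFlow f p.1 p.2) '' (Icc (-η) η ×ˢ A) with hG
  have hGc : IsCompact G := (isCompact_Icc.prod hA).image (continuous_odeFlow hf)
  have hGU : G ⊆ flowBox f S δ := by
    rintro _ ⟨⟨t, x⟩, ⟨ht, hx⟩, rfl⟩
    exact hS.flow_mem_box (hAS hx) (abs_lt.2 ⟨by linarith [ht.1], by linarith [ht.2]⟩)
  obtain ⟨r, hr, hrU⟩ := hGc.exists_cthickening_subset_open hS.isOpen_box hGU
  refine ⟨r, hr, Metric.cthickening r G, hrU, hGc.cthickening, fun x hx t ht => ?_⟩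
  have hmem : odeFlow f t x ∈ G := ⟨(t, x), ⟨ht, hx⟩, rfl⟩
  exact Metric.closedBall_subset_cthickening hmem r

/-- Solutions of the delay equation cross the level sets of `α` transversally. -/
theorem IsSection.eventually_strictMonoOn (hS : IsSection f S δ α a)
    (hg : BoundedLipschitz g Mg Lg) (τ : ℝ≥0) {Q : Set (Fin d → ℝ)} (hQ : IsCompact Q)
    (hQU : Q ⊆ flowBox f S δ) :
    ∀ᶠ ε in 𝓝 (0 : ℝ), ∀ (φ : Phase τ d) (u : C(ℝ, Fin d → ℝ)), IsDDESolution f g τ ε φ u →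
      ∀ s t, 0 ≤ s → (∀ r ∈ Icc s t, u r ∈ Q) → StrictMonoOn (fun r => α (u r)) (Icc s t) := by
  have hfd : ContinuousOn (fderiv ℝ α) Q :=
    (hS.contDiff.continuousOn_fderiv_of_isOpen hS.isOpen_box le_rfl).mono hQU
  obtain ⟨B, hB⟩ := hQ.exists_bound_of_continuousOn hfd
  have hlim : Tendsto (fun ε : ℝ => B * (|ε| * Mg)) (𝓝 0) (𝓝 0) := by
    have : Continuous fun ε : ℝ => B * (|ε| * Mg) := by fun_prop
    simpa using this.tendsto 0
  -- On `Q` the derivative of `α` along a solution is at least `a - B |ε| Mg`.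
  filter_upwards [hlim.eventually (gt_mem_nhds hS.a_pos)] with ε hε φ u hu s t hs hmem
  refine strictMonoOn_of_deriv_pos (convex_Icc s t) ?_ ?_
  · exact hS.contDiff.continuousOn.comp u.continuous.continuousOn fun r hr => hQU (hmem r hr)
  · intro r hr
    rw [interior_Icc] at hr
    have hrQ := hmem r (Ioo_subset_Icc_self hr)
    have hα : DifferentiableAt ℝ α (u r) :=
      (hS.contDiff.contDiffAt (hS.isOpen_box.mem_nhds (hQU hrQ))).differentiableAt one_ne_zero
    have hd := hα.hasFDerivAt.comp_hasDerivAt r (hu.hasDerivAt (hs.trans_lt hr.1))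
    have hd' := hd.deriv
    simp only [Function.comp_def] at hd'
    rw [hd', map_add]
    have h1 := hS.transversal _ (hQU hrQ)
    have h2 : |fderiv ℝ α (u r) (ε • g (u (r - τ)))| ≤ B * (|ε| * Mg) :=
      (fderiv ℝ α (u r)).le_of_opNorm_le_of_le (hB _ hrQ) (norm_smul_le_of_bound hg ε _)
    linarith [(abs_le.1 h2).1]

/-- For small `ε` the trajectories that start over a compact set `A` stay in the flow box during
the time window, cross the section there transversally, and do so near the time of the ODE. -/
theorem eventually_window (hf : BoundedLipschitz f Mf Lf) (hg : BoundedLipschitz g Mg Lg)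
    (hS : IsSection f S δ α a) (hD : IsReturnDomain f S D) (τ : ℝ≥0)
    (hA : IsCompact A) (hAD : A ⊆ D) (hP : ContinuousOn (odePoincare f S) A)
    (hηδ : η < δ) {β : ℝ} (hβ : 0 < β) (hβη : β ≤ η) :
    ∀ᶠ ε in 𝓝 (0 : ℝ), ∀ (φ : Phase τ d) (u : C(ℝ, Fin d → ℝ)), IsDDESolution f g τ ε φ u →
      φ (zeroPt τ) ∈ A →
      (∀ t ∈ Icc (odeReturnTime f S (φ (zeroPt τ)) - η) (odeReturnTime f S (φ (zeroPt τ)) + η),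
        u t ∈ flowBox f S δ) ∧
      StrictMonoOn (fun t => α (u t))
        (Icc (odeReturnTime f S (φ (zeroPt τ)) - η) (odeReturnTime f S (φ (zeroPt τ)) + η)) ∧
      ∃ t ∈ Icc (odeReturnTime f S (φ (zeroPt τ)) - β) (odeReturnTime f S (φ (zeroPt τ)) + β),
        u t ∈ S := by
  have hTc := continuousOn_odeReturnTime hf hS hD hAD hP
  obtain ⟨B, hB⟩ := hA.exists_bound_of_continuousOn hTc
  have hPA : IsCompact (odePoincare f S '' A) := hA.image_of_continuousOn hP
  have hPS : odePoincare f S '' A ⊆ S := by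
    rintro _ ⟨x, hx, rfl⟩
    exact (odeReturnTime_spec hf hS hD (hAD hx)).2
  have hc : ∀ t, Continuous fun v => odeFlow f t v := fun t =>
    (continuous_odeFlow hf).comp (continuous_const.prodMk continuous_id)
  have hβδ : |β| < δ := by rw [abs_of_pos hβ]; linarith
  have hβδ' : |-β| < δ := by rwa [abs_neg]
  obtain ⟨r, hr, Q, hQU, hQ, hball⟩ := hS.exists_cthickening_subset hf hηδ hPA hPS
  -- Flowing the compact set `P(A)` by `±β` puts it into the open sets `α > 0` and `α < 0`;
  -- compactness yields uniform margins `r₁`, `r₂` within which perturbed trajectories keep these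
  -- signs.
  obtain ⟨r₁, hr₁, hpos⟩ := (hPA.image (hc β)).exists_cthickening_subset_open hS.isOpen_pos (by
    rintro _ ⟨y, hy, rfl⟩
    exact ⟨hS.flow_mem_box (hPS hy) hβδ, hS.pos_after β ⟨hβ, by linarith⟩ y (hPS hy)⟩)
  obtain ⟨r₂, hr₂, hneg⟩ := (hPA.image (hc (-β))).exists_cthickening_subset_open hS.isOpen_neg (by
    rintro _ ⟨y, hy, rfl⟩
    exact ⟨hS.flow_mem_box (hPS hy) hβδ',
      hS.neg_before (-β) ⟨by linarith, by linarith⟩ y (hPS hy)⟩)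
  filter_upwards [eventually_dist_odeFlow_le hf hg τ (B + η) (lt_min hr (lt_min hr₁ hr₂)),
    hS.eventually_strictMonoOn hg τ hQ hQU] with ε hclose hmono φ u hu hφ
  set x := φ (zeroPt τ) with hx
  set T := odeReturnTime f S x with hT
  have hTδ : δ ≤ T := le_odeReturnTime hf hS hD (hAD hφ)
  have hTB : T ≤ B := (le_abs_self _).trans (hB x hφ)
  have hyA : odePoincare f S x ∈ odePoincare f S '' A := mem_image_of_mem _ hφ
  have hflow : ∀ t, odeFlow f t x = odeFlow f (t - T) (odePoincare f S x) := fun t => by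
    rw [odePoincare, ← odeFlow_add hf, sub_add_cancel]
  have hd : ∀ t ∈ Icc (T - η) (T + η),
      dist (u t) (odeFlow f (t - T) (odePoincare f S x)) ≤ min r (min r₁ r₂) := by
    intro t ht
    rw [← hflow]
    exact hclose φ u hu t ⟨by linarith [ht.1], by linarith [ht.2]⟩
  have hmem : ∀ t ∈ Icc (T - η) (T + η), u t ∈ Q := fun t ht =>
    hball _ hyA (t - T) ⟨by linarith [ht.1], by linarith [ht.2]⟩
      ((hd t ht).trans (min_le_left _ _))
  refine ⟨fun t ht => hQU (hmem t ht), hmono φ u hu _ _ (by linarith) hmem, ?_⟩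
  have hsub : Icc (T - β) (T + β) ⊆ Icc (T - η) (T + η) :=
    Icc_subset_Icc (by linarith) (by linarith)
  have h1 : 0 ≤ α (u (T + β)) := by
    refine le_of_lt (hpos (Metric.mem_cthickening_of_dist_le (u (T + β)) _ _ _
      (mem_image_of_mem _ hyA) ?_)).2
    have := hd (T + β) (hsub (right_mem_Icc.2 (by linarith)))
    rw [add_sub_cancel_left] at this
    exact this.trans ((min_le_right _ _).trans (min_le_left _ _))
  have h2 : α (u (T - β)) ≤ 0 := by
    refine le_of_lt (hneg (Metric.mem_cthickening_of_dist_le (u (T - β)) _ _ _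
      (mem_image_of_mem _ hyA) ?_)).2
    have := hd (T - β) (hsub (left_mem_Icc.2 (by linarith)))
    rw [sub_sub_cancel_left] at this
    exact this.trans ((min_le_right _ _).trans (min_le_right _ _))
  have hcont : ContinuousOn (fun t => α (u t)) (Icc (T - β) (T + β)) :=
    hS.contDiff.continuousOn.comp u.continuous.continuousOn fun t ht => hQU (hmem t (hsub ht))
  obtain ⟨t, ht, ht0⟩ := intermediate_value_Icc (by linarith) hcont
    (show (0 : ℝ) ∈ Icc _ _ from ⟨h2, h1⟩)
  exact ⟨t, ht, hS.mem_of_eq_zero (hQU (hmem t (hsub ht))) ht0⟩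

/-- For the parameter `ε`, each trajectory starting over `A` stays in the flow box during the time
window and crosses the section there exactly once. -/
def HasUniqueCrossings (f g : (Fin d → ℝ) → (Fin d → ℝ)) (τ : ℝ≥0) (ε : ℝ)
    (S : Set (Fin d → ℝ)) (δ η : ℝ) (A : Set (Fin d → ℝ)) : Prop :=
  ∀ φ : Phase τ d, φ (zeroPt τ) ∈ A →
    (∀ t ∈ Icc (odeReturnTime f S (φ (zeroPt τ)) - η) (odeReturnTime f S (φ (zeroPt τ)) + η),
      ddeSol f g ε φ t ∈ flowBox f S δ) ∧ ∃! t, IsNearCrossing f g ε S η φ t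

theorem ddeReturnTime_eq {ε : ℝ} {φ : Phase τ d} {t : ℝ}
    (h : ∃! t, IsNearCrossing f g ε S η φ t) (ht : IsNearCrossing f g ε S η φ t) :
    ddeReturnTime f g ε S η φ = t := by
  have : {t | IsNearCrossing f g ε S η φ t} = {t} := by
    ext s
    exact ⟨fun hs => h.unique hs ht, fun hs => by rw [mem_singleton_iff.1 hs]; exact ht⟩
  rw [ddeReturnTime, this, csInf_singleton]

theorem isNearCrossing_ddeReturnTime {ε : ℝ} {φ : Phase τ d}
    (h : ∃! t, IsNearCrossing f g ε S η φ t) :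
    IsNearCrossing f g ε S η φ (ddeReturnTime f g ε S η φ) := by
  obtain ⟨t, ht⟩ := h.exists
  rwa [ddeReturnTime_eq h ht]

theorem eventually_hasUniqueCrossings (hf : BoundedLipschitz f Mf Lf)
    (hg : BoundedLipschitz g Mg Lg) (hS : IsSection f S δ α a) (hD : IsReturnDomain f S D)
    (hτ : 0 < τ) (hA : IsCompact A) (hAD : A ⊆ D) (hP : ContinuousOn (odePoincare f S) A)
    (hη : 0 < η) (hηδ : η < δ) : ∀ᶠ ε in 𝓝 (0 : ℝ), HasUniqueCrossings f g τ ε S δ η A := by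
  filter_upwards [eventually_window hf hg hS hD τ hA hAD hP hηδ hη le_rfl] with ε h φ hφ
  obtain ⟨h1, h2, t, ht, htS⟩ := h φ _ (isDDESolution_ddeSol hf hg hτ ε φ) hφ
  refine ⟨h1, t, ⟨ht, by rwa [ddeSemiflow_zeroPt hf hg hτ]⟩, ?_⟩
  rintro s ⟨hs, hsS⟩
  rw [ddeSemiflow_zeroPt hf hg hτ] at hsS
  exact h2.injOn hs ht ((hS.eq_zero hsS).trans (hS.eq_zero htS).symm)

/-- Two errors of at most `ρ / 3` each: the trajectory against the orbit at the same time, and the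
orbit between the two crossing times, at most `β` apart, at speed at most `Mf`. Uniqueness in the
`η`-window identifies the crossing found in the `β`-window. -/
theorem eventually_dist_ddePoincare_lt (hf : BoundedLipschitz f Mf Lf)
    (hg : BoundedLipschitz g Mg Lg) (hS : IsSection f S δ α a) (hD : IsReturnDomain f S D)
    (hτ : 0 < τ) (hA : IsCompact A) (hAD : A ⊆ D) (hP : ContinuousOn (odePoincare f S) A)
    (hη : 0 < η) (hηδ : η < δ) {ρ : ℝ} (hρ : 0 < ρ) :
    ∀ᶠ ε in 𝓝 (0 : ℝ), ∀ φ : Phase τ d, φ (zeroPt τ) ∈ A →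
      dist (ddePoincare f g ε S η φ (zeroPt τ)) (odePoincare f S (φ (zeroPt τ))) < ρ := by
  obtain ⟨B, hB⟩ := hA.exists_bound_of_continuousOn
    (continuousOn_odeReturnTime hf hS hD hAD hP)
  have hMf := hf.bound_pos
  set β := min η (ρ / (3 * Mf)) with hβdef
  have hβ : 0 < β := lt_min hη (by positivity)
  have hβη : β ≤ η := min_le_left _ _
  have hMβ : Mf * β ≤ ρ / 3 := by
    calc Mf * β ≤ Mf * (ρ / (3 * Mf)) := by gcongr; exact min_le_right _ _
      _ = ρ / 3 := by field_simp
  filter_upwards [eventually_hasUniqueCrossings hf hg hS hD hτ hA hAD hP hη hηδ,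
    eventually_window hf hg hS hD τ hA hAD hP hηδ hβ hβη,
    eventually_dist_odeFlow_le hf hg τ (B + η) (show 0 < ρ / 3 by positivity)]
    with ε huniq hwin hclose φ hφ
  have hu := isDDESolution_ddeSol hf hg hτ ε φ
  obtain ⟨-, -, t, ht, htS⟩ := hwin φ _ hu hφ
  have hTδ := le_odeReturnTime hf hS hD (hAD hφ)
  have hTB := (le_abs_self _).trans (hB _ hφ)
  have hnear : IsNearCrossing f g ε S η φ t :=
    ⟨⟨by linarith [ht.1], by linarith [ht.2]⟩, by rwa [ddeSemiflow_zeroPt hf hg hτ]⟩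
  rw [ddePoincare, ddeReturnTime_eq (huniq φ hφ).2 hnear, ddeSemiflow_zeroPt hf hg hτ]
  have h1 := hclose φ _ hu t ⟨by linarith [ht.1], by linarith [ht.2]⟩
  have h2 := dist_odeFlow_time_le hf t (odeReturnTime f S (φ (zeroPt τ))) (φ (zeroPt τ))
  have h3 : |t - odeReturnTime f S (φ (zeroPt τ))| ≤ β :=
    abs_le.2 ⟨by linarith [ht.1], by linarith [ht.2]⟩
  have h4 := mul_le_mul_of_nonneg_left h3 hMf.le
  have h5 := dist_triangle (ddeSol f g ε φ t) (odeFlow f t (φ (zeroPt τ)))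
    (odePoincare f S (φ (zeroPt τ)))
  unfold odePoincare at h5 ⊢
  linarith

/-- Closed graph argument: return times stay in a compact interval, and any cluster value as `ψ → φ`
is a crossing time of `φ` in its window, so uniqueness determines it. -/
theorem HasUniqueCrossings.continuousOn_ddeReturnTime {ε : ℝ} (hf : BoundedLipschitz f Mf Lf)
    (hg : BoundedLipschitz g Mg Lg) (hS : IsSection f S δ α a) (hD : IsReturnDomain f S D)
    (hτ : 0 < τ) (hA : IsCompact A) (hAD : A ⊆ D)
    (hT : ContinuousOn (odeReturnTime f S) A) (hηδ : η < δ)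
    (h : HasUniqueCrossings f g τ ε S δ η A) :
    ContinuousOn (fun φ : Phase τ d => ddeReturnTime f g ε S η φ) {φ | φ (zeroPt τ) ∈ A} := by
  obtain ⟨B, hB⟩ := hA.exists_bound_of_continuousOn hT
  set Z := {φ : Phase τ d | φ (zeroPt τ) ∈ A} with hZ
  have hTZ : ContinuousOn (fun φ : Phase τ d => odeReturnTime f S (φ (zeroPt τ))) Z :=
    hT.comp (continuous_eval_const (zeroPt τ)).continuousOn fun φ hφ => hφ
  have hmem : ∀ φ ∈ Z, ddeReturnTime f g ε S η φ ∈ Icc 0 (B + η) := by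
    intro φ hφ
    have h1 := (isNearCrossing_ddeReturnTime (h φ hφ).2).1
    have h2 := le_odeReturnTime hf hS hD (hAD hφ)
    have h3 := (le_abs_self _).trans (hB _ hφ)
    exact ⟨by linarith [h1.1], by linarith [h1.2]⟩
  intro φ hφ
  refine isCompact_Icc.tendsto_nhds_of_unique_mapClusterPt (s := Icc 0 (B + η))
    (eventually_nhdsWithin_of_forall hmem) ?_
  intro t ht hcl
  obtain ⟨G, hG, hGt⟩ := mapClusterPt_iff_ultrafilter.1 hcl
  have hGZ : ∀ᶠ ψ in (G : Filter (Phase τ d)), ψ ∈ Z := hG self_mem_nhdsWithin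
  have hGT : Tendsto (fun ψ : Phase τ d => odeReturnTime f S (ψ (zeroPt τ))) G
      (𝓝 (odeReturnTime f S (φ (zeroPt τ)))) := (hTZ φ hφ).mono_left hG
  have hwin : t ∈ Icc (odeReturnTime f S (φ (zeroPt τ)) - η)
      (odeReturnTime f S (φ (zeroPt τ)) + η) := by
    constructor
    · refine le_of_tendsto_of_tendsto (hGT.sub_const η) hGt (hGZ.mono fun ψ hψ => ?_)
      exact (isNearCrossing_ddeReturnTime (h ψ hψ).2).1.1
    · refine le_of_tendsto_of_tendsto hGt (hGT.add_const η) (hGZ.mono fun ψ hψ => ?_)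
      exact (isNearCrossing_ddeReturnTime (h ψ hψ).2).1.2
  have hGφ : Tendsto (fun ψ : Phase τ d => (ddeReturnTime f g ε S η ψ, ψ)) G
      (𝓝[Ici 0 ×ˢ univ] (t, φ)) := by
    refine tendsto_nhdsWithin_iff.2
      ⟨hGt.prodMk_nhds (tendsto_id.mono_left (hG.trans nhdsWithin_le_nhds)), hGZ.mono ?_⟩
    exact fun ψ hψ => ⟨(hmem ψ hψ).1, mem_univ _⟩
  have hGu := (continuousOn_ddeSol hf hg hτ ε (t, φ) ⟨ht.1, mem_univ _⟩).tendsto.comp hGφ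
  -- As `S` may fail to be closed, the limit is taken in the equation `α = 0`; membership in the box
  -- then gives membership in `S`.
  have hbox := (h φ hφ).1 t hwin
  have hα := (hS.contDiff.continuousOn.continuousAt (hS.isOpen_box.mem_nhds hbox)).tendsto.comp hGu
  have hzero : α (ddeSol f g ε φ t) = 0 := by
    refine tendsto_nhds_unique_of_eventuallyEq hα tendsto_const_nhds (hGZ.mono fun ψ hψ => ?_)
    have := (isNearCrossing_ddeReturnTime (h ψ hψ).2).2
    rw [ddeSemiflow_zeroPt hf hg hτ] at this
    exact hS.eq_zero this
  refine (ddeReturnTime_eq (h φ hφ).2 ⟨hwin, ?_⟩).symm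
  rw [ddeSemiflow_zeroPt hf hg hτ]
  exact hS.mem_of_eq_zero hbox hzero

theorem HasUniqueCrossings.ddeReturnTime_pos {ε : ℝ} (hf : BoundedLipschitz f Mf Lf)
    (hS : IsSection f S δ α a) (hD : IsReturnDomain f S D) (hAD : A ⊆ D) (hηδ : η < δ)
    (h : HasUniqueCrossings f g τ ε S δ η A) {φ : Phase τ d} (hφ : φ (zeroPt τ) ∈ A) :
    0 < ddeReturnTime f g ε S η φ := by
  have h1 := (isNearCrossing_ddeReturnTime (h φ hφ).2).1.1
  have h2 := le_odeReturnTime hf hS hD (hAD hφ)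
  linarith

theorem HasUniqueCrossings.continuousOn_ddePoincare {ε : ℝ} (hf : BoundedLipschitz f Mf Lf)
    (hg : BoundedLipschitz g Mg Lg) (hS : IsSection f S δ α a) (hD : IsReturnDomain f S D)
    (hτ : 0 < τ) (hA : IsCompact A) (hAD : A ⊆ D)
    (hT : ContinuousOn (odeReturnTime f S) A) (hηδ : η < δ)
    (h : HasUniqueCrossings f g τ ε S δ η A) :
    ContinuousOn (fun φ : Phase τ d => ddePoincare f g ε S η φ) {φ | φ (zeroPt τ) ∈ A} :=
  (continuousOn_ddeSemiflow hf hg hτ ε).comp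
    ((h.continuousOn_ddeReturnTime hf hg hS hD hτ hA hAD hT hηδ).prodMk continuousOn_id)
    fun _ hφ => ⟨(h.ddeReturnTime_pos hf hS hD hAD hηδ hφ).le, mem_univ _⟩

/-- If `P` is continuous on its domain, the crossing in the time window is the first return. -/
theorem eventually_isLeast_ddeReturnTime (hf : BoundedLipschitz f Mf Lf)
    (hg : BoundedLipschitz g Mg Lg) (hS : IsSection f S δ α a) (hD : IsReturnDomain f S D)
    (hτ : 0 < τ) (hA : IsCompact A) (hAD : A ⊆ D) (hP : ContinuousOn (odePoincare f S) D)
    (hη : 0 < η) (hηδ : η < δ) :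
    ∀ᶠ ε in 𝓝 (0 : ℝ), ∀ φ : Phase τ d, φ (zeroPt τ) ∈ A →
      IsLeast {t : ℝ | 0 < t ∧ ddeSemiflow f g ε t φ (zeroPt τ) ∈ S}
        (ddeReturnTime f g ε S η φ) := by
  have hTD := continuousOn_odeReturnTime hf hS hD subset_rfl hP
  have hTA := hTD.mono hAD
  obtain ⟨B, hB⟩ := hA.exists_bound_of_continuousOn hTA
  obtain ⟨r, hr, Q, hQU, hQ, hball⟩ :=
    hS.exists_cthickening_subset hf hηδ hA (hAD.trans hD.subset)
  -- The orbit pieces between times `η` and `t_P - η`, parametrised over `[0, 1]` because `t_P`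
  -- varies with the point. Both endpoints lie in `(0, t_P)`, hence so does the whole piece, even if
  -- `t_P < 2η` and it is run backward.
  set G := (fun p : ℝ × (Fin d → ℝ) =>
    odeFlow f ((1 - p.1) * η + p.1 * (odeReturnTime f S p.2 - η)) p.2) '' (Icc 0 1 ×ˢ A) with hG
  have hGc : IsCompact G := by
    refine (isCompact_Icc.prod hA).image_of_continuousOn ?_
    have h1 : ContinuousOn (fun p : ℝ × (Fin d → ℝ) => odeReturnTime f S p.2) (Icc 0 1 ×ˢ A) :=
      hTA.comp continuousOn_snd fun p hp => hp.2
    have h2 : ContinuousOn (fun p : ℝ × (Fin d → ℝ) =>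
        ((1 - p.1) * η + p.1 * (odeReturnTime f S p.2 - η), p.2)) (Icc 0 1 ×ˢ A) := by fun_prop
    exact (continuous_odeFlow hf).comp_continuousOn h2
  have hGS : G ⊆ (closure S)ᶜ := by
    rintro _ ⟨⟨s, x⟩, ⟨hs, hx⟩, rfl⟩
    have hTδ := le_odeReturnTime hf hS hD (hAD hx)
    have hs0 : 0 ≤ s := hs.1
    have hs1 : 0 ≤ 1 - s := sub_nonneg.2 hs.2
    refine odeFlow_notMem_closure hf hS hD hTD (hAD hx) ?_ ?_
    · dsimp only
      nlinarith [mul_nonneg hs0 (show 0 ≤ odeReturnTime f S x - η - min η (δ - η) by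
        linarith [min_le_right η (δ - η)]), mul_nonneg hs1 (show 0 ≤ η - min η (δ - η) by
        linarith [min_le_left η (δ - η)]), lt_min hη (sub_pos.2 hηδ)]
    · dsimp only
      nlinarith [mul_nonneg hs0 hη.le, mul_nonneg hs1 (show 0 ≤ odeReturnTime f S x - δ by
        linarith), mul_nonneg hs1 (sub_pos.2 hηδ).le, mul_nonneg hs0 (sub_pos.2 hηδ).le]
  obtain ⟨r', hr', hGr⟩ := hGc.exists_cthickening_subset_open isClosed_closure.isOpen_compl hGS
  filter_upwards [eventually_hasUniqueCrossings hf hg hS hD hτ hA hAD (hP.mono hAD) hη hηδ,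
    eventually_dist_odeFlow_le hf hg τ (B + η) (lt_min hr hr'),
    hS.eventually_strictMonoOn hg τ hQ hQU] with ε huniq hclose hmono φ hφ
  have hu := isDDESolution_ddeSol hf hg hτ ε φ
  have hnear := isNearCrossing_ddeReturnTime (huniq φ hφ).2
  have hTδ := le_odeReturnTime hf hS hD (hAD hφ)
  have hTB := (le_abs_self _).trans (hB _ hφ)
  refine ⟨⟨huniq.ddeReturnTime_pos hf hS hD hAD hηδ hφ, hnear.2⟩, ?_⟩
  rintro t ⟨ht0, htS⟩
  by_contra! hlt
  have htS' := htS
  rw [ddeSemiflow_zeroPt hf hg hτ] at htS'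
  rcases le_or_gt (odeReturnTime f S (φ (zeroPt τ)) - η) t with h1 | h1
  · exact hlt.ne' (ddeReturnTime_eq (huniq φ hφ).2 ⟨⟨h1, hlt.le.trans hnear.1.2⟩, htS⟩)
  rcases le_total t η with h2 | h2
  -- Just after the start, `α` increases strictly from its value `0` at `φ(0) ∈ S`.
  · have hm : ∀ s ∈ Icc 0 η, ddeSol f g ε φ s ∈ Q := fun s hs =>
      hball _ hφ s ⟨by linarith [hs.1], hs.2⟩
        ((hclose φ _ hu s ⟨hs.1, by linarith [hs.2]⟩).trans (min_le_left _ _))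
    have := hmono φ _ hu 0 η le_rfl hm (left_mem_Icc.2 hη.le) ⟨ht0.le, h2⟩ ht0
    simp only [hu.apply_zero, hS.eq_zero (hD.subset (hAD hφ)), hS.eq_zero htS'] at this
    exact lt_irrefl _ this
  -- In the middle range the trajectory is within `r'` of `G`, hence off the closure of `S`.
  · have hlen : 0 < odeReturnTime f S (φ (zeroPt τ)) - η - η := by linarith
    refine hGr (Metric.mem_cthickening_of_dist_le _ (odeFlow f t (φ (zeroPt τ))) _ _ ?_
      ((hclose φ _ hu t ⟨ht0.le, by linarith⟩).trans (min_le_right _ _))) (subset_closure htS')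
    refine ⟨((t - η) / (odeReturnTime f S (φ (zeroPt τ)) - η - η), φ (zeroPt τ)),
      ⟨⟨by have := sub_nonneg.2 h2; positivity, (div_le_one hlen).2 (by linarith)⟩, hφ⟩, ?_⟩
    dsimp only
    congr 1
    field_simp
    ring

end Return

/-! ### Persistence of covering relations -/

section Covering

variable {m : ℕ} {N M : HSet m} {F : ℝ × (Fin m → ℝ) → ℝ × (Fin m → ℝ)}

theorem HSet.symm_mem_support (N : HSet m) {z : ℝ × (Fin m → ℝ)}
    (hz : z ∈ Icc (-1 : ℝ) 1 ×ˢ Metric.closedBall (0 : Fin m → ℝ) 1) : N.c.symm z ∈ N.support := by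
  rw [← N.image_support] at hz
  obtain ⟨x, hx, rfl⟩ := hz
  rwa [N.c.symm_apply_apply]

theorem HSet.exit_subset (N : HSet m) : N.exit ⊆ N.support := by
  intro x hx
  rw [← N.c.symm_apply_apply x]
  refine N.symm_mem_support ⟨?_, hx.2⟩
  rcases hx.1 with h | h <;> rw [h] <;> simp

theorem HSet.isCompact_exit (N : HSet m) : IsCompact N.exit := by
  refine N.isCompact_support.of_isClosed_subset (IsClosed.preimage N.c.continuous ?_) N.exit_subset
  exact (Set.toFinite ({-1, 1} : Set ℝ)).isClosed.prod Metric.isClosed_closedBall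

theorem HSet.isClosed_entry (N : HSet m) : IsClosed N.entry :=
  (isClosed_Icc.prod isClosed_frontier).preimage N.c.continuous

theorem isCompactMapOn_of_isCompact {X Y : Type*} [PseudoMetricSpace X] [TopologicalSpace Y]
    [T2Space Y] {F : X → Y} {D : Set X} (hD : IsCompact D) (hF : ContinuousOn F D) :
    IsCompactMapOn F D :=
  ⟨hF, fun _ hA _ => (hD.image_of_continuousOn hF).closure_of_subset (image_mono hA)⟩

/-- A covering relation in finite dimension persists for maps on h-sets with Lipschitz tails whose
head is close to the given map and which preserve the tail. -/
theorem HSet.Covers.exists_withLipTail (h : N.Covers F M) :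
    ∃ γ > 0, ∀ (τ : ℝ≥0) (d : ℕ) (L : ℝ), 0 ≤ L →
      ∀ G : (ℝ × (Fin m → ℝ)) × TailSpace τ d → (ℝ × (Fin m → ℝ)) × TailSpace τ d,
        ContinuousOn G (N.support ×ˢ lipTail τ d L) →
        (∀ x ∈ N.support, ∀ r ∈ lipTail τ d L,
          dist (G (x, r)).1 (F x) < γ ∧ (G (x, r)).2 ∈ lipTail τ d L) →
        (withLipTail τ d L N).Covers G (withLipTail τ d L M) := by
  obtain ⟨hF, H, hH, hH0, hexit, hentry, b, hb, hend⟩ := h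
  -- The images of the homotopy are compact and avoid the closed sets `|M|` (from the exit set) and
  -- `M⁺`, so they avoid them with margins `γ₁` and `γ₂`.
  obtain ⟨γ₁, hγ₁, h₁⟩ := ((isCompact_Icc.prod N.isCompact_exit).image_of_continuousOn
    (hH.mono (prod_mono_right N.exit_subset))).exists_cthickening_subset_open
    M.isCompact_support.isClosed.isOpen_compl (by
      rintro _ ⟨⟨t, x⟩, ⟨ht, hx⟩, rfl⟩
      exact hexit t ht x hx)
  obtain ⟨γ₂, hγ₂, h₂⟩ := ((isCompact_Icc.prod N.isCompact_support).image_of_continuousOn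
    hH).exists_cthickening_subset_open M.isClosed_entry.isOpen_compl (by
      rintro _ ⟨⟨t, x⟩, ⟨ht, hx⟩, rfl⟩
      exact hentry t ht x hx)
  -- The margin is fixed before `L`, as required for `L = Mf + |ε| Mg`, which varies with `ε`.
  refine ⟨min γ₁ γ₂, lt_min hγ₁ hγ₂, fun τ d L hL G hG hclose => ?_⟩
  have hcompact : IsCompact (N.support ×ˢ lipTail τ d L) :=
    N.isCompact_support.prod (isCompact_lipTail τ d hL)
  have hzero : (0 : TailSpace τ d) ∈ lipTail τ d L := fun s t => by
    simp only [ZeroMemClass.coe_zero, ContinuousMap.zero_apply, sub_self, norm_zero]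
    positivity
  have hdist : ∀ t ∈ Icc (0 : ℝ) 1, ∀ x ∈ N.support, ∀ r ∈ lipTail τ d L,
      dist (H (t, x) + (1 - t) • ((G (x, r)).1 - F x)) (H (t, x)) ≤ min γ₁ γ₂ := by
    intro t ht x hx r hr
    rw [dist_eq_norm, add_sub_cancel_left, norm_smul, Real.norm_of_nonneg (sub_nonneg.2 ht.2),
      ← dist_eq_norm]
    exact (mul_le_of_le_one_left dist_nonneg (by linarith [ht.1])).trans (hclose x hx r hr).1.le
  refine ⟨isCompactMapOn_of_isCompact hcompact hG,
    -- Adding `(1 - t)(G₁ - F)` makes the head start at `G₁` and end at the model map `H(1, ·)`,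
    -- always less than the margin away from `H`. The tail shrinks to `0`.
    fun p => (H (p.1, p.2.1) + (1 - p.1) • ((G p.2).1 - F p.2.1), (1 - p.1) • (G p.2).2),
    isCompactMapOn_of_isCompact (isCompact_Icc.prod hcompact) ?_, ?_, ?_, ?_, ?_, b, hb, 0,
    hzero, ?_⟩
  · have e1 : ContinuousOn (fun p : ℝ × ((ℝ × (Fin m → ℝ)) × TailSpace τ d) => G p.2)
        (Icc 0 1 ×ˢ (N.support ×ˢ lipTail τ d L)) :=
      hG.comp continuousOn_snd fun p hp => hp.2
    have e2 : ContinuousOn (fun p : ℝ × ((ℝ × (Fin m → ℝ)) × TailSpace τ d) => F p.2.1)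
        (Icc 0 1 ×ˢ (N.support ×ˢ lipTail τ d L)) :=
      hF.comp (by fun_prop) fun p hp => hp.2.1
    have e3 : ContinuousOn (fun p : ℝ × ((ℝ × (Fin m → ℝ)) × TailSpace τ d) => H (p.1, p.2.1))
        (Icc 0 1 ×ˢ (N.support ×ˢ lipTail τ d L)) :=
      hH.comp (by fun_prop) fun p hp => ⟨hp.1, hp.2.1⟩
    exact (e3.add ((continuousOn_const.sub continuousOn_fst).smul (e1.fst.sub e2))).prodMk
      ((continuousOn_const.sub continuousOn_fst).smul e1.snd)
  · rintro t ht ⟨x, r⟩ ⟨hx, hr⟩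
    exact (convex_lipTail τ d L).smul_mem_of_zero_mem hzero (hclose x hx r hr).2
      ⟨sub_nonneg.2 ht.2, by linarith [ht.1]⟩
  · rintro ⟨x, r⟩ ⟨hx, hr⟩
    simp [hH0 x hx]
  · rintro t ht ⟨x, r⟩ ⟨hx, hr⟩ ⟨hmem, -⟩
    exact h₁ (Metric.mem_cthickening_of_dist_le _ (H (t, x)) _ _ ⟨(t, x), ⟨ht, hx⟩, rfl⟩
      ((hdist t ht x (N.exit_subset hx) r hr).trans (min_le_left _ _))) hmem
  · rintro t ht ⟨x, r⟩ ⟨hx, hr⟩ ⟨hmem, -⟩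
    exact h₂ (Metric.mem_cthickening_of_dist_le _ (H (t, x)) _ _ ⟨(t, x), ⟨ht, hx⟩, rfl⟩
      ((hdist t ht x hx r hr).trans (min_le_right _ _))) hmem
  · intro p hp q hq r _
    have := hend p hp q hq
    simpa [withLipTail] using this

end Covering

/-- Uniform continuity of a continuous function near a compact subset of its domain. -/
theorem exists_dist_lt_of_continuousOn {X Y : Type*} [PseudoMetricSpace X] [PseudoMetricSpace Y]
    {h : X → Y} {s K : Set X} (hK : IsCompact K) (hKs : K ⊆ s) (hh : ContinuousOn h s)
    {γ : ℝ} (hγ : 0 < γ) :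
    ∃ ρ > 0, ∀ y ∈ K, ∀ z ∈ s, dist z y < ρ → dist (h z) (h y) < γ := by
  have hK' : IsCompact ((↑) ⁻¹' K : Set s) := by
    rw [Subtype.isCompact_iff, Subtype.image_preimage_coe, inter_eq_right.2 hKs]
    exact hK
  have := hK'.uniformContinuousAt_of_continuousAt (s.domRestrict h)
    (fun x _ => (continuousOn_iff_continuous_domRestrict.1 hh).continuousAt)
    (Metric.dist_mem_uniformity hγ)
  obtain ⟨ρ, hρ, hu⟩ := Metric.mem_uniformity_dist.1 this
  refine ⟨ρ, hρ, fun y hy z hz hzy => ?_⟩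
  rw [dist_comm] at hzy ⊢
  exact hu (a := ⟨y, hKs hy⟩) (b := ⟨z, hz⟩) hzy hy

/-! ### Persistence of a covering relation under the delayed perturbation -/

section Main

variable {m d : ℕ} {f g : (Fin d → ℝ) → (Fin d → ℝ)} {Mf Mg : ℝ} {Lf Lg : ℝ≥0} {τ : ℝ≥0}
  {S D : Set (Fin d → ℝ)} {δ a η : ℝ} {α : (Fin d → ℝ) → ℝ}

/-- Covering provides continuity of `P` only in coordinates. Since `P` lands in the chart domain, it
equals `κ⁻¹ ∘ P_κ ∘ κ` on the preimage of `X`, where `P_κ` is the map in coordinates. -/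
theorem continuousOn_odePoincare_image {κ : SectionChart S m} {X : Set (ℝ × (Fin m → ℝ))}
    (hX : X ⊆ κ.target) (hP : ∀ x ∈ X, odePoincare f S (κ.invFun x) ∈ κ.source)
    (hc : ContinuousOn (odePoincareCoord f κ) X) :
    ContinuousOn (odePoincare f S) (κ.invFun '' X) := by
  have hinv : ∀ x ∈ X, κ.toFun (κ.invFun x) = x := fun x hx => κ.right_inv' (hX hx)
  have h1 : ContinuousOn κ.toFun (κ.invFun '' X) := κ.continuousOn_toFun.mono (by
    rintro _ ⟨x, hx, rfl⟩
    exact κ.map_target' (hX hx))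
  have h2 : ContinuousOn (fun y => κ.invFun (odePoincareCoord f κ (κ.toFun y)))
      (κ.invFun '' X) := by
    refine κ.continuousOn_invFun.comp (hc.comp h1 ?_) ?_
    · rintro _ ⟨x, hx, rfl⟩
      rwa [hinv x hx]
    · rintro _ ⟨x, hx, rfl⟩
      simp only [hinv x hx]
      exact κ.map_source' (hP x hx)
  refine h2.congr ?_
  rintro _ ⟨x, hx, rfl⟩
  simp only [hinv x hx]
  exact (κ.left_inv' (hP x hx)).symm

/-- The chart domain is `S ∩ O` with `O` open: the crossing point is in `S` by construction and in
`O` by closeness to the compact set `P(A)`. Uniform continuity of `κ` near `P(A)` transfers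
closeness to coordinates. -/
theorem eventually_ddePoincare_mem_source (hf : BoundedLipschitz f Mf Lf)
    (hg : BoundedLipschitz g Mg Lg) (hS : IsSection f S δ α a) (hD : IsReturnDomain f S D)
    (hτ : 0 < τ) (κ : SectionChart S m) {A : Set (Fin d → ℝ)} (hA : IsCompact A) (hAD : A ⊆ D)
    (hP : ContinuousOn (odePoincare f S) A) (hPκ : odePoincare f S '' A ⊆ κ.source)
    (hη : 0 < η) (hηδ : η < δ) {γ : ℝ} (hγ : 0 < γ) :
    ∀ᶠ ε in 𝓝 (0 : ℝ), ∀ φ : Phase τ d, φ (zeroPt τ) ∈ A →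
      ddePoincare f g ε S η φ (zeroPt τ) ∈ κ.source ∧
      dist (κ.toFun (ddePoincare f g ε S η φ (zeroPt τ)))
        (κ.toFun (odePoincare f S (φ (zeroPt τ)))) < γ := by
  obtain ⟨O, hO, hsource⟩ := κ.relOpen_source
  have hPA := hA.image_of_continuousOn hP
  obtain ⟨ρ₁, hρ₁, h₁⟩ := hPA.exists_thickening_subset_open hO
    (hPκ.trans (hsource.trans_subset inter_subset_right))
  obtain ⟨ρ₂, hρ₂, h₂⟩ := exists_dist_lt_of_continuousOn hPA hPκ κ.continuousOn_toFun hγ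
  filter_upwards [eventually_hasUniqueCrossings hf hg hS hD hτ hA hAD hP hη hηδ,
    eventually_dist_ddePoincare_lt hf hg hS hD hτ hA hAD hP hη hηδ (lt_min hρ₁ hρ₂)]
    with ε huniq hdist φ hφ
  have hd := hdist φ hφ
  have hmem : ddePoincare f g ε S η φ (zeroPt τ) ∈ κ.source := by
    rw [hsource]
    refine ⟨(isNearCrossing_ddeReturnTime (huniq φ hφ).2).2, h₁ (Metric.mem_thickening_iff.2
      ⟨_, mem_image_of_mem _ hφ, hd.trans_le (min_le_left _ _)⟩)⟩
  exact ⟨hmem, h₂ _ (mem_image_of_mem _ hφ) _ hmem (hd.trans_le (min_le_right _ _))⟩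

/-- Persistence of a single covering relation. -/
theorem eventually_covers (hf : BoundedLipschitz f Mf Lf)
    (hg : BoundedLipschitz g Mg Lg) (hS : IsSection f S δ α a) (hD : IsReturnDomain f S D)
    (hτ : 0 < τ) (κ : SectionChart S m) {N M : HSet m}
    (hN : N.support ⊆ κ.target ∩ κ.invFun ⁻¹' D)
    (hPκ : ∀ x ∈ N.support, odePoincare f S (κ.invFun x) ∈ κ.source)
    (hcov : N.Covers (odePoincareCoord f κ) M) (hη : 0 < η) (hηδ : η < δ) :
    ∀ᶠ ε in 𝓝 (0 : ℝ),
      (∀ φ : Phase τ d, φ (zeroPt τ) ∈ κ.invFun '' N.support →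
        (∃! t, IsNearCrossing f g ε S η φ t) ∧
        ddePoincare f g ε S η φ (zeroPt τ) ∈ κ.source) ∧
      (withLipTail τ d (Mf + |ε| * Mg) N).Covers (ddePoincareCoord f g τ ε η κ)
        (withLipTail τ d (Mf + |ε| * Mg) M) ∧
      (ContinuousOn (odePoincare f S) D →
        ∀ φ : Phase τ d, φ (zeroPt τ) ∈ κ.invFun '' N.support →
          IsLeast {t : ℝ | 0 < t ∧ ddeSemiflow f g ε t φ (zeroPt τ) ∈ S}
            (ddeReturnTime f g ε S η φ)) := by
  set A := κ.invFun '' N.support with hAdef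
  have hκinv : ContinuousOn κ.invFun N.support :=
    κ.continuousOn_invFun.mono fun x hx => (hN hx).1
  have hA : IsCompact A := N.isCompact_support.image_of_continuousOn hκinv
  have hAD : A ⊆ D := by
    rintro _ ⟨x, hx, rfl⟩
    exact (hN hx).2
  have hP : ContinuousOn (odePoincare f S) A :=
    continuousOn_odePoincare_image (fun x hx => (hN hx).1) hPκ hcov.1
  have hPA : odePoincare f S '' A ⊆ κ.source := by
    rintro _ ⟨_, ⟨x, hx, rfl⟩, rfl⟩
    exact hPκ x hx
  have hT := continuousOn_odeReturnTime hf hS hD hAD hP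
  obtain ⟨γ, hγ, hpersist⟩ := hcov.exists_withLipTail
  have hleast : ∀ᶠ ε in 𝓝 (0 : ℝ), ContinuousOn (odePoincare f S) D →
      ∀ φ : Phase τ d, φ (zeroPt τ) ∈ A →
        IsLeast {t : ℝ | 0 < t ∧ ddeSemiflow f g ε t φ (zeroPt τ) ∈ S}
          (ddeReturnTime f g ε S η φ) :=
    eventually_imp_distrib_left.2 fun hPD =>
      eventually_isLeast_ddeReturnTime hf hg hS hD hτ hA hAD hPD hη hηδ
  filter_upwards [eventually_hasUniqueCrossings hf hg hS hD hτ hA hAD hP hη hηδ,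
    eventually_ddePoincare_mem_source hf hg hS hD hτ κ hA hAD hP hPA hη hηδ hγ, hleast]
    with ε huniq hsource hleast
  refine ⟨fun φ hφ => ⟨(huniq φ hφ).2, (hsource φ hφ).1⟩, ?_, hleast⟩
  have hMf := hf.bound_pos
  have hMg := hg.bound_pos
  have hmaps : ∀ x ∈ N.support, ∀ r : TailSpace τ d, glue (κ.invFun x) r (zeroPt τ) ∈ A := by
    intro x hx r
    rw [glue_zeroPt]
    exact mem_image_of_mem _ hx
  refine hpersist τ d _ (by positivity) _ ?_ fun x hx r hr => ⟨?_, ?_⟩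
  · have h1 : ContinuousOn (fun x : (ℝ × (Fin m → ℝ)) × TailSpace τ d =>
        ddePoincare f g ε S η (glue (κ.invFun x.1) x.2))
        (N.support ×ˢ lipTail τ d (Mf + |ε| * Mg)) := by
      refine (huniq.continuousOn_ddePoincare hf hg hS hD hτ hA hAD hT hηδ).comp
        (continuous_glue.comp_continuousOn
          ((hκinv.comp continuousOn_fst fun x hx => hx.1).prodMk continuousOn_snd)) ?_
      exact fun x hx => hmaps x.1 hx.1 x.2
    refine ContinuousOn.prodMk (κ.continuousOn_toFun.comp
      ((continuous_eval_const (zeroPt τ)).comp_continuousOn h1) ?_)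
      (continuous_tailOf.comp_continuousOn h1)
    exact fun x hx => (hsource _ (hmaps x.1 hx.1 x.2)).1
  · have := (hsource _ (hmaps x hx r)).2
    rwa [glue_zeroPt] at this
  · exact tailOf_ddeSemiflow_mem_lipTail hf hg hτ
      (huniq.ddeReturnTime_pos hf hS hD hAD hηδ (hmaps x hx r)).le _ hr

end Main

end DelayPerturb

end

theorem theorem3 {m : ℕ} (hm : 1 ≤ m)
    {f g : (Fin (m + 2) → ℝ) → (Fin (m + 2) → ℝ)} {Mf Mg : ℝ} {Lf Lg : ℝ≥0}
    (hf : DelayPerturb.BoundedLipschitz f Mf Lf) (hg : DelayPerturb.BoundedLipschitz g Mg Lg)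
    {τ : ℝ≥0} (hτ : 0 < τ)
    -- the section, the domain of the Poincaré map, and coordinates on the section
    {S D : Set (Fin (m + 2) → ℝ)} {δ a : ℝ} {α : (Fin (m + 2) → ℝ) → ℝ}
    (hS : DelayPerturb.IsSection f S δ α a) (hD : DelayPerturb.IsReturnDomain f S D)
    (κ : DelayPerturb.SectionChart S m)
    -- the h-sets and the covering relations
    {ι : Type*} [Finite ι] (N : ι → DelayPerturb.HSet m)
    (hN : ∀ i, (N i).support ⊆ κ.target ∩ κ.invFun ⁻¹' D)
    (C : Set (ι × ι))
    (hP : ∀ p ∈ C, ∀ x ∈ (N p.1).support,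
      DelayPerturb.odePoincare f S (κ.invFun x) ∈ κ.source)
    (hC : DelayPerturb.IsCoveringCollection N C (DelayPerturb.odePoincareCoord f κ))
    -- the half-width of the time window
    {η : ℝ} (hη : 0 < η) (hηδ : η < δ) :
    ∃ εC : ℝ, 0 < εC ∧ ∀ ε : ℝ, |ε| ≤ εC →
      -- the Poincaré map of the delay equation is well defined
      (∀ p ∈ C, ∀ φ : DelayPerturb.Phase τ (m + 2),
        φ (DelayPerturb.zeroPt τ) ∈ κ.invFun '' (N p.1).support →
          (∃! t, DelayPerturb.IsNearCrossing f g ε S η φ t) ∧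
          DelayPerturb.ddePoincare f g ε S η φ (DelayPerturb.zeroPt τ) ∈ κ.source) ∧
      -- the covering relations persist
      DelayPerturb.IsTailCoveringCollection
        (fun i => DelayPerturb.withLipTail τ (m + 2) (Mf + |ε| * Mg) (N i)) C
        (DelayPerturb.ddePoincareCoord f g τ ε η κ) ∧
      -- it is the first return map whenever `P` is continuous on its domain
      (ContinuousOn (DelayPerturb.odePoincare f S) D →
        ∀ p ∈ C, ∀ φ : DelayPerturb.Phase τ (m + 2),
          φ (DelayPerturb.zeroPt τ) ∈ κ.invFun '' (N p.1).support →
            IsLeast {t : ℝ | 0 < t ∧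
                DelayPerturb.ddeSemiflow f g ε t φ (DelayPerturb.zeroPt τ) ∈ S}
              (DelayPerturb.ddeReturnTime f g ε S η φ)) := by
  have hev := (Filter.eventually_all_finite (Set.toFinite C)).2 fun p hp =>
    DelayPerturb.eventually_covers hf hg hS hD hτ κ (hN p.1) (hP p hp) (hC p hp) hη hηδ
  obtain ⟨e, he, h⟩ := Metric.eventually_nhds_iff.1 hev
  -- Finiteness of `C` gave one open ball of radius `e` for all pairs; halving accommodates the
  -- non-strict bound on `|ε|`.
  refine ⟨e / 2, half_pos he, fun ε hε => ?_⟩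
  have hε' : dist ε 0 < e := by
    rw [Real.dist_eq, sub_zero]
    linarith
  exact ⟨fun p hp => (h hε' p hp).1, fun p hp => (h hε' p hp).2.1,
    fun hcont p hp => (h hε' p hp).2.2 hcont⟩
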